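/- Let $E = \mathbb{R} \times \{-1,+1\}$ and let $C_0(E)$ be the Banach space of real continuous functions on $E$ vanishing at infinity. Let $a > 0$ and let $\lambda : E \to [0,\infty)$ be continuous. Suppose there are constants $y_0 \ge 0$ and $\lambda_{\min} > 0$ such that $\lambda(y,j) \ge \lambda_{\min}$ whenever $jy \ge y_0$. Let $L$ be the operator on $C_0(E)$ \[ L\varphi(y,j) = a j\, \partial_y \varphi(y,j) + \lambda(y,j)\,(\varphi(y,-j) - \varphi(y,j)), \] with domain $D(L)$ the set of $\varphi \in C_0(E)$ such that $\varphi(\cdot,\pm 1) \in C^1(\mathbb{R})$ and $L\varphi \in C_0(E)$. Put $F(t;y,j) = \exp\bigl(-\int_0^t \lambda(y+ajs,j)\,ds\bigr)$ for $t \ge 0$. For $(y,j) \in E$, the zig-zag process started in $(y,j)$ is constructed as follows. Let $T_0 = 0$, $(Y(0),J(0)) = (y,j)$. For $i = 1,2,\dots$ let $Z_i$ be a strictly positive random variable with $\mathbb{P}_{y,j}(Z_i > t \mid Z_1,\dots,Z_{i-1}) = F(t; Y(T_{i-1}), J(T_{i-1}))$ for all $t \ge 0$, let $T_i = T_{i-1}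 + Z_i$, and put $J(t) = J(T_{i-1})$ for $T_{i-1} \le t < T_i$, $J(T_i) = -J(T_{i-1})$, and $Y(t) = Y(T_{i-1}) + a J(T_{i-1})(t - T_{i-1})$ for $T_{i-1} \le t \le T_i$. (On the event $\lim_k T_k < \infty$ put, as a mere convention, $(Y(t),J(t)) = (y+ajt,j)$ for $t \ge \lim_k T_k$.) Let $\mathcal{F}_t = \sigma((Y(s),J(s)) : s \le t)$. Then such random variables $Z_i$ exist for every $(y,j) \in E$, and: 1. (Non-explosion) $T_k \to \infty$ as $k \to \infty$, $\mathbb{P}_{y,j}$-almost surely, for every $(y,j) \in E$. 2. (Strong Markov property) There is a semigroup $(P(t))_{t\ge 0}$ of Markov kernels on $E$, with $P(0)$ the identity, such that $P(t)((y,j),\cdot)$ is the law of $(Y(t),J(t))$ under $\mathbb{P}_{y,j}$, and for every $(y,j) \in E$, every $(\mathcal{F}_t)$-stopping time $\tau$ with values in $[0,\infty]$, every $t \ge 0$ and every bounded Borel function $f : E \to \mathbb{R}$, $\mathbb{P}_{y,j}$-almost surely \[ \mathbb{E}_{y,j}\bigl[f(Y(\tau+t),J(\tau+t))\,\mathbf{1}_{\{\tau<\infty\}}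 \mid \mathcal{F}_\tau\bigr] = \mathbf{1}_{\{\tau<\infty\}}\,(P(t)f)(Y(\tau),J(\tau)). \] 3. (Generator) $L$ is closable, and its closure is the infinitesimal generator of $(P(t))$ on $C_0(E)$, that is, the operator whose graph is the set of all $(\varphi,g) \in C_0(E) \times C_0(E)$ with $\lim_{t \downarrow 0} \sup_{x \in E} \bigl| t^{-1}(P(t)\varphi(x) - \varphi(x)) - g(x) \bigr| = 0$. -/

import Mathlib

open MeasureTheory ProbabilityTheory Filter Topology Set
open scoped NNReal ZeroAtInfty

namespace ZigZag

/-- The state space `E = ℝ × {-1, +1}`; `ℤˣ = {1, -1}` carries the discrete topology. -/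
abbrev E : Type := ℝ × ℤˣ

/-- The direction `j ∈ {-1, +1}` as a real number. -/
abbrev sgn (j : ℤˣ) : ℝ := ((j : ℤ) : ℝ)

instance : DiscreteMeasurableSpace ℤˣ where
  forall_measurableSet s := ⟨Units.val '' s, MeasurableSet.of_discrete, by
    ext j; simp [Units.val_inj]⟩

instance : BorelSpace ℤˣ where
  measurable_eq := by
    rw [borel_eq_top_of_discrete]
    exact top_unique fun s _ => MeasurableSet.of_discrete

noncomputable section

/-! ### The operator on `C₀(E)` -/

/-- The expression `a j ∂φ/∂y (y, j) + lam (y, j) (φ (y, -j) - φ (y, j))`. -/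
def genExpr (a : ℝ) (lam : E → ℝ) (φ : E → ℝ) (x : E) : ℝ :=
  a * sgn x.2 * deriv (fun y : ℝ => φ (y, x.2)) x.1 + lam x * (φ (x.1, -x.2) - φ x)

/-- `φ ∈ D(L)`: both `φ(·, ±1)` are continuously differentiable and `L φ` is continuous and
vanishes at infinity. -/
def InDomain (a : ℝ) (lam : E → ℝ) (φ : E → ℝ) : Prop :=
  (∀ j : ℤˣ, ContDiff ℝ 1 (fun y : ℝ => φ (y, j))) ∧
    Continuous (genExpr a lam φ) ∧ Tendsto (genExpr a lam φ) (cocompact E) (𝓝 0)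

lemma genExpr_add {a : ℝ} {lam φ ψ : E → ℝ}
    (hφ : ∀ j : ℤˣ, ContDiff ℝ 1 (fun y : ℝ => φ (y, j)))
    (hψ : ∀ j : ℤˣ, ContDiff ℝ 1 (fun y : ℝ => ψ (y, j))) :
    genExpr a lam (φ + ψ) = genExpr a lam φ + genExpr a lam ψ := by
  funext x
  have h1 : deriv (fun y : ℝ => (φ + ψ) (y, x.2)) x.1
      = deriv (fun y : ℝ => φ (y, x.2)) x.1 + deriv (fun y : ℝ => ψ (y, x.2)) x.1 :=
    deriv_fun_add ((hφ x.2).differentiable (by simp) x.1) ((hψ x.2).differentiable (by simp) x.1)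
  simp only [genExpr, Pi.add_apply] at h1 ⊢
  rw [h1]
  ring

lemma genExpr_smul {a : ℝ} {lam φ : E → ℝ} (c : ℝ) :
    genExpr a lam (c • φ) = c • genExpr a lam φ := by
  funext x
  have h1 : deriv (fun y : ℝ => (c • φ) (y, x.2)) x.1
      = c * deriv (fun y : ℝ => φ (y, x.2)) x.1 := by
    simp only [Pi.smul_apply, smul_eq_mul]
    exact deriv_const_mul_field c
  simp only [genExpr, Pi.smul_apply, smul_eq_mul] at h1 ⊢
  rw [h1]
  ring

/-- The domain of `L` as a linear subspace of `C₀(E)`. -/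
def genDomain (a : ℝ) (lam : E → ℝ) : Submodule ℝ C₀(E, ℝ) where
  carrier := {φ | InDomain a lam φ}
  zero_mem' := by
    have h : genExpr a lam (⇑(0 : C₀(E, ℝ))) = fun _ => 0 := by
      funext x; simp [genExpr]
    refine ⟨fun j => ?_, ?_, ?_⟩
    · simpa using (contDiff_const : ContDiff ℝ 1 fun _ : ℝ => (0 : ℝ))
    · rw [h]; exact continuous_const
    · rw [h]; exact tendsto_const_nhds
  add_mem' := by
    rintro φ ψ ⟨h1, h2, h3⟩ ⟨k1, k2, k3⟩
    have h := genExpr_add (a := a) (lam := lam) h1 k1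
    refine ⟨fun j => by simpa using (h1 j).add (k1 j), ?_, ?_⟩
    · rw [ZeroAtInftyContinuousMap.coe_add, h]; exact h2.add k2
    · have h4 := h3.add k3
      rw [add_zero] at h4
      rw [ZeroAtInftyContinuousMap.coe_add, h]; exact h4
  smul_mem' := by
    rintro c φ ⟨h1, h2, h3⟩
    have h := genExpr_smul (a := a) (lam := lam) (φ := φ) c
    refine ⟨fun j => by simpa using contDiff_const.mul (h1 j), ?_, ?_⟩
    · rw [ZeroAtInftyContinuousMap.coe_smul, h]; exact h2.const_smul c
    · have h4 := h3.const_smul c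
      rw [smul_zero] at h4
      rw [ZeroAtInftyContinuousMap.coe_smul, h]; exact h4

/-- The unbounded operator `L` on `C₀(E)`,
`L φ (y, j) = a j ∂φ/∂y (y, j) + lam (y, j) (φ (y, -j) - φ (y, j))`. -/
def L (a : ℝ) (lam : E → ℝ) : C₀(E, ℝ) →ₗ.[ℝ] C₀(E, ℝ) where
  domain := genDomain a lam
  toFun :=
    { toFun := fun φ => ⟨⟨genExpr a lam φ.1, φ.2.2.1⟩, φ.2.2.2⟩
      map_add' := fun φ ψ => by
        ext x
        exact congrFun (genExpr_add φ.2.1 ψ.2.1) x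
      map_smul' := fun c φ => by
        ext x
        exact congrFun (genExpr_smul c) x }

/-! ### The process -/

/-- The survival function `F(t; y, j) = exp (-∫₀ᵗ lam (y + a j s, j) ds)`. -/
def survival (a : ℝ) (lam : E → ℝ) (t : ℝ) (x : E) : ℝ :=
  Real.exp (-∫ s in (0 : ℝ)..t, lam (x.1 + a * sgn x.2 * s, x.2))

/-- The state `(Y(T_n), J(T_n))` at the `n`-th switch, for the initial state `e` and the waiting
times `z 0, z 1, …` (`z n` is the time between the `n`-th and the `(n+1)`-st switch). -/
def skeleton (a : ℝ) (e : E) (z : ℕ → Ioi (0 : ℝ)) : ℕ → E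
  | 0 => e
  | n + 1 => ((skeleton a e z n).1 + a * sgn (skeleton a e z n).2 * (z n : ℝ),
      -(skeleton a e z n).2)

/-- The time `T_n` of the `n`-th switch. -/
def switchTime (z : ℕ → Ioi (0 : ℝ)) (n : ℕ) : ℝ := ∑ k ∈ Finset.range n, (z k : ℝ)

/-- The number `N(t)` of switches up to time `t` (it has the default value `0` if there are
infinitely many of them). -/
def switchCount (z : ℕ → Ioi (0 : ℝ)) (t : ℝ≥0) : ℕ := sSup {k : ℕ | switchTime z k ≤ t}

/-- The zig-zag path `(Y(t), J(t))` with initial state `e` and waiting times `z`: for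
`T_n ≤ t < T_{n+1}` it is `(Y(T_n) + a J(T_n) (t - T_n), J(T_n))`. -/
def path (a : ℝ) (e : E) (z : ℕ → Ioi (0 : ℝ)) (t : ℝ≥0) : E :=
  ((skeleton a e z (switchCount z t)).1
      + a * sgn (skeleton a e z (switchCount z t)).2 * ((t : ℝ) - switchTime z (switchCount z t)),
    (skeleton a e z (switchCount z t)).2)

lemma measurable_skeleton (a : ℝ) (e : E) (n : ℕ) :
    Measurable (fun z : ℕ → Ioi (0 : ℝ) => skeleton a e z n) := by
  have hs : Measurable sgn := measurable_of_countable _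
  have hn : Measurable (fun j : ℤˣ => -j) := measurable_of_countable _
  induction n with
  | zero => exact measurable_const
  | succ n ih =>
    have hz : Measurable (fun z : ℕ → Ioi (0 : ℝ) => ((z n : Ioi (0 : ℝ)) : ℝ)) :=
      measurable_subtype_coe.comp (measurable_pi_apply n)
    exact (ih.fst.add (((hs.comp ih.snd).const_mul a).mul hz)).prodMk (hn.comp ih.snd)

lemma measurable_switchTime (n : ℕ) : Measurable (fun z => switchTime z n) :=
  Finset.measurable_sum _ fun k _ => measurable_subtype_coe.comp (measurable_pi_apply k)

lemma measurable_switchCount (t : ℝ≥0) : Measurable (fun z => switchCount z t) := by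
  have h : ∀ k, MeasurableSet {z : ℕ → Ioi (0 : ℝ) | switchTime z k ≤ t} := fun k =>
    measurableSet_le (measurable_switchTime k) measurable_const
  refine measurable_of_Iic fun n => ?_
  have h1 : (fun z => switchCount z t) ⁻¹' Iic n
      = (⋂ k : ℕ, ⋃ m ≥ k, {z : ℕ → Ioi (0 : ℝ) | switchTime z m ≤ t})
        ∪ ⋂ k ∈ {k : ℕ | n < k}, {z : ℕ → Ioi (0 : ℝ) | switchTime z k ≤ t}ᶜ := by
    ext z
    simp only [switchCount, mem_preimage, mem_Iic, mem_union, mem_iInter, mem_iUnion, mem_ofPred_eq,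
      mem_compl_iff, exists_prop]
    constructor
    · intro hz
      by_cases hb : BddAbove {k : ℕ | switchTime z k ≤ t}
      · exact Or.inr fun k hk hk' => absurd ((le_csSup hb hk').trans hz) (not_le.mpr hk)
      · refine Or.inl fun k => ?_
        obtain ⟨m, hm, hkm⟩ := not_bddAbove_iff.mp hb k
        exact ⟨m, hkm.le, hm⟩
    · rintro (hz | hz)
      · have hb : ¬ BddAbove {k : ℕ | switchTime z k ≤ t} := by
          refine not_bddAbove_iff.mpr fun k => ?_
          obtain ⟨m, hkm, hm⟩ := hz (k + 1)
          exact ⟨m, hm, hkm⟩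
        rw [Nat.sSup_of_not_bddAbove hb]
        exact Nat.zero_le n
      · exact csSup_le' fun k hk => not_lt.mp fun hnk => hz k hnk hk
  rw [h1]
  refine MeasurableSet.union ?_ ?_
  · exact MeasurableSet.iInter fun k => MeasurableSet.iUnion fun m => MeasurableSet.iUnion fun _ =>
      h m
  · exact MeasurableSet.iInter fun k => MeasurableSet.iInter fun _ => (h k).compl

lemma measurable_path (a : ℝ) (e : E) (t : ℝ≥0) : Measurable (fun z => path a e z t) := by
  have hs : Measurable sgn := measurable_of_countable _
  have key : ∀ n, Measurable (fun z : ℕ → Ioi (0 : ℝ) =>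
      (((skeleton a e z n).1 + a * sgn (skeleton a e z n).2 * ((t : ℝ) - switchTime z n),
        (skeleton a e z n).2) : E)) := fun n =>
    ((measurable_skeleton a e n).fst.add (((hs.comp (measurable_skeleton a e n).snd).const_mul a).mul
      ((measurable_switchTime n).const_sub _))).prodMk (measurable_skeleton a e n).snd
  have h2 : Measurable (fun p : (ℕ → Ioi (0 : ℝ)) × ℕ =>
      (((skeleton a e p.1 p.2).1 + a * sgn (skeleton a e p.1 p.2).2 * ((t : ℝ) - switchTime p.1 p.2),
        (skeleton a e p.1 p.2).2) : E)) := measurable_from_prod_countable_left key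
  exact h2.comp (measurable_id.prodMk (measurable_switchCount t))

/-- `Z 0, Z 1, …` are, under `μ`, waiting times between the switches of a zig-zag process started
in `e`: given `Z 0, …, Z (n-1)`, the probability that `Z n > t` is `F(t; Y(T_n), J(T_n))`. -/
structure IsWaitingTimes {Ω : Type*} [MeasurableSpace Ω] (a : ℝ) (lam : E → ℝ) (e : E)
    (μ : Measure Ω) (Z : ℕ → Ω → Ioi (0 : ℝ)) : Prop where
  isProbabilityMeasure : IsProbabilityMeasure μ
  measurable : ∀ n, Measurable (Z n)
  condProb : ∀ (n : ℕ) (t : ℝ), 0 ≤ t →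
    μ⟦{ω | t < (Z n ω : ℝ)} | ⨆ k : Fin n, MeasurableSpace.comap (Z k) inferInstance⟧
      =ᵐ[μ] fun ω => survival a lam t (skeleton a e (fun k => Z k ω) n)

/-- The zig-zag process `(Y(t), J(t))` started in `e` with waiting times `Z`. -/
def process {Ω : Type*} (a : ℝ) (e : E) (Z : ℕ → Ω → Ioi (0 : ℝ)) (t : ℝ≥0) (ω : Ω) : E :=
  path a e (fun k => Z k ω) t

lemma measurable_process {Ω : Type*} [MeasurableSpace Ω] (a : ℝ) (e : E)
    {Z : ℕ → Ω → Ioi (0 : ℝ)} (hZ : ∀ n, Measurable (Z n)) (t : ℝ≥0) :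
    Measurable (process a e Z t) :=
  (measurable_path a e t).comp (measurable_pi_lambda _ hZ)

/-- The filtration `ℱ_t = σ((Y(s), J(s)) : s ≤ t)`. -/
def filtration {Ω : Type*} [m : MeasurableSpace Ω] (a : ℝ) (e : E)
    {Z : ℕ → Ω → Ioi (0 : ℝ)} (hZ : ∀ n, Measurable (Z n)) : Filtration ℝ≥0 m :=
  Filtration.natural (process a e Z) fun t => (measurable_process a e hZ t).stronglyMeasurable

/-! ### Markov processes and generators -/

/-- `P` is a (conservative, measurable) Markov transition semigroup on `S`. -/
structure IsMarkovSemigroup {S : Type*} [MeasurableSpace S] (P : ℝ≥0 → Kernel S S) : Prop where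
  isMarkovKernel : ∀ t, IsMarkovKernel (P t)
  zero : P 0 = Kernel.id
  add : ∀ s t, P (s + t) = P t ∘ₖ P s

/-- `X` is, under `μ`, a strong Markov process with respect to `ℱ` with transition semigroup `P`:
it is adapted, and for all stopping times `τ`, all `t ≥ 0` and all bounded measurable `f`,
`E[f(X_{τ+t}) 1_{τ<∞} | ℱ_τ] = 1_{τ<∞} (P_t f)(X_τ)` almost surely. -/
structure IsStrongMarkov {Ω S : Type*} [m : MeasurableSpace Ω] [MeasurableSpace S]
    (μ : Measure Ω) (ℱ : Filtration ℝ≥0 m) (X : ℝ≥0 → Ω → S) (P : ℝ≥0 → Kernel S S) : Prop where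
  adapted : ∀ t, Measurable[ℱ t] (X t)
  strong_markov : ∀ (τ : Ω → WithTop ℝ≥0) (hτ : IsStoppingTime ℱ τ) (t : ℝ≥0) (f : S → ℝ),
    Measurable f → (∃ C, ∀ x, |f x| ≤ C) →
    μ[{ω | τ ω < ⊤}.indicator fun ω => f (X ((τ ω).untopD 0 + t) ω) | hτ.measurableSpace]
      =ᵐ[μ] {ω | τ ω < ⊤}.indicator fun ω => ∫ x, f x ∂(P t (X ((τ ω).untopD 0) ω))

/-- The graph of the infinitesimal generator on `C₀(S)` of a transition semigroup `P`: all pairs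
`(φ, g)` in `C₀(S) × C₀(S)` such that `(P_t φ - φ) / t → g` uniformly on `S` as `t ↓ 0`. -/
def generatorGraph {S : Type*} [TopologicalSpace S] [MeasurableSpace S] (P : ℝ≥0 → Kernel S S) :
    Set (C₀(S, ℝ) × C₀(S, ℝ)) :=
  {p | TendstoUniformly (fun (t : ℝ≥0) (x : S) => (∫ z, p.1 z ∂(P t x) - p.1 x) / (t : ℝ))
    p.2 (𝓝[>] 0)}

end

end ZigZag

/-!
Up to time `t` the path stays within distance `|a| t` of its starting point, where the jump rate is
bounded by some `M`, so the number of switches is dominated by that of a Poisson process of rate `M`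
and the process does not explode. The survival function is multiplicative along the flow, i.e. the
waiting times are memoryless, and this gives the Markov property at fixed times with respect to the
whole past. The semigroup is Feller; approximating a stopping time from above by dyadic ones and
using right-continuity of the paths then yields the strong Markov property.

For the generator, conditioning on the first switch gives a renewal equation for `P_t f`, and
differentiating it at `t = 0` shows that the graph of the generator is contained in that of `L`.
Conversely `1 - L` is injective by the positive maximum principle, while `1 - A` is onto `C₀(E)` for
the generator `A` of a contraction semigroup, with inverse the resolvent `R f = ∫ e^{-t} P_t f dt`.
Hence `A = L`, and `L` is closed since `R` is continuous.
-/

namespace ZigZag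

open scoped BoundedContinuousFunction

/-! ### Strong Markov property of right-continuous Feller processes -/

section StrongMarkov

/-- The smallest multiple of `2⁻ⁿ` that is strictly larger than `t`: stopping times are approximated
from above by their images under it, which take countably many values. The inequality is strict so
that the event `dyadicAbove n τ = (k + 1) / 2ⁿ` is known at time `(k + 1) / 2ⁿ`. -/
noncomputable def dyadicAbove (n : ℕ) (t : ℝ≥0) : ℝ≥0 := (⌊2 ^ n * t⌋₊ + 1) / 2 ^ n

lemma lt_dyadicAbove (n : ℕ) (t : ℝ≥0) : t < dyadicAbove n t := by
  rw [dyadicAbove, lt_div_iff₀ (by positivity), mul_comm]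
  exact Nat.lt_floor_add_one _

lemma dyadicAbove_le (n : ℕ) (t : ℝ≥0) : dyadicAbove n t ≤ t + (1 / 2) ^ n := by
  have h : (⌊2 ^ n * t⌋₊ : ℝ≥0) ≤ 2 ^ n * t := Nat.floor_le (by positivity)
  rw [dyadicAbove, div_le_iff₀ (by positivity), add_mul, ← mul_pow, mul_comm t]
  gcongr
  norm_num

lemma tendsto_dyadicAbove (t : ℝ≥0) : Tendsto (fun n => dyadicAbove n t) atTop (𝓝[≥] t) := by
  refine tendsto_nhdsWithin_iff.mpr ⟨?_, .of_forall fun n => (lt_dyadicAbove n t).le⟩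
  refine tendsto_of_tendsto_of_tendsto_of_le_of_le tendsto_const_nhds ?_
    (fun n => (lt_dyadicAbove n t).le) (fun n => dyadicAbove_le n t)
  have h : Tendsto (fun n : ℕ => ((1 / 2 : ℝ≥0)) ^ n) atTop (𝓝 0) :=
    NNReal.tendsto_pow_atTop_nhds_zero_of_lt_one (by rw [div_lt_one] <;> norm_num)
  simpa using h.const_add t

lemma continuousWithinAt_Ici_comp {Y : Type*} [TopologicalSpace Y] {u : ℝ≥0 → Y}
    {v : ℝ≥0 → ℝ≥0} {t : ℝ≥0} (hu : ContinuousWithinAt u (Ici (v t)) (v t)) (hv : Continuous v)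
    (hv' : Monotone v) : ContinuousWithinAt (fun s => u (v s)) (Ici t) t :=
  hu.comp hv.continuousWithinAt fun _ hs => hv' hs

section Sampling

variable {Ω S : Type*} [MeasurableSpace Ω] [TopologicalSpace S] [MeasurableSpace S]
  {X : ℝ≥0 → Ω → S} {σ : Ω → ℝ≥0}

omit [TopologicalSpace S] in
lemma measurable_sample_dyadicAbove (hX : ∀ t, Measurable (X t)) (hσ : Measurable σ) (n : ℕ) :
    Measurable fun ω => X (dyadicAbove n (σ ω)) ω := by
  have hX' : Measurable fun q : ℕ × Ω => X ((q.1 + 1) / 2 ^ n) q.2 :=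
    measurable_from_prod_countable_right fun k => hX ((k + 1) / 2 ^ n)
  have hfloor : Measurable fun ω => ⌊2 ^ n * σ ω⌋₊ :=
    Nat.measurable_floor.comp (hσ.const_mul (2 ^ n))
  simpa only [Function.comp_def, dyadicAbove, id] using
    hX'.comp (hfloor.prodMk measurable_id)

omit [MeasurableSpace Ω] [MeasurableSpace S] in
lemma tendsto_sample_dyadicAbove {ω : Ω}
    (hr : ContinuousWithinAt (fun s => X s ω) (Ici (σ ω)) (σ ω)) :
    Tendsto (fun n => X (dyadicAbove n (σ ω)) ω) atTop (𝓝 (X (σ ω) ω)) :=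
  hr.tendsto.comp (tendsto_dyadicAbove (σ ω))

lemma measurable_sample_of_rightContinuous [TopologicalSpace.PseudoMetrizableSpace S]
    [BorelSpace S] (hX : ∀ t, Measurable (X t))
    (hr : ∀ ω t, ContinuousWithinAt (fun s => X s ω) (Ici t) t) (hσ : Measurable σ) :
    Measurable fun ω => X (σ ω) ω :=
  measurable_of_tendsto_metrizable (measurable_sample_dyadicAbove hX hσ)
    (tendsto_pi_nhds.mpr fun ω => tendsto_sample_dyadicAbove (hr ω (σ ω)))

lemma tendsto_setIntegral_sample_dyadicAbove {μ : Measure Ω} [IsFiniteMeasure μ]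
    {Y : ℝ≥0 → Ω → ℝ} (hY : ∀ t, Measurable (Y t))
    (hr : ∀ ω t, ContinuousWithinAt (fun s => Y s ω) (Ici t) t) {C : ℝ} (hC : ∀ t ω, ‖Y t ω‖ ≤ C)
    (hσ : Measurable σ) (A : Set Ω) :
    Tendsto (fun n => ∫ ω in A, Y (dyadicAbove n (σ ω)) ω ∂μ) atTop
      (𝓝 (∫ ω in A, Y (σ ω) ω ∂μ)) :=
  tendsto_integral_of_dominated_convergence (fun _ => C)
    (fun n => (measurable_sample_dyadicAbove hY hσ n).aestronglyMeasurable) (integrable_const _)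
    (fun _ => .of_forall fun _ => hC _ _)
    (.of_forall fun ω => tendsto_sample_dyadicAbove (hr ω (σ ω)))

end Sampling

variable {Ω S : Type*} {m : MeasurableSpace Ω} {ℱ : Filtration ℝ≥0 m}

lemma isStronglyProgressive_of_rightContinuous [TopologicalSpace S]
    [TopologicalSpace.PseudoMetrizableSpace S] [MeasurableSpace S] [BorelSpace S]
    [SecondCountableTopology S] {X : ℝ≥0 → Ω → S} (hX : ∀ t, Measurable[ℱ t] (X t))
    (hr : ∀ ω t, ContinuousWithinAt (fun s => X s ω) (Ici t) t) :
    IsStronglyProgressive ℱ X := by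
  intro i
  let _ := ℱ i
  have hmeas : Measurable fun p : Iic i × Ω => X (min p.1 i) p.2 :=
    measurable_sample_of_rightContinuous (X := fun t (p : Iic i × Ω) => X (min t i) p.2)
      (fun t => ((hX _).mono (ℱ.mono (min_le_right t i)) le_rfl).comp measurable_snd)
      (fun p t => continuousWithinAt_Ici_comp (hr p.2 _) (by fun_prop)
        fun _ _ hst => min_le_min_right i hst)
      (measurable_subtype_coe.comp measurable_fst)
  have hmin : (fun p : Iic i × Ω => X (min p.1 i) p.2) = fun p => X p.1 p.2 :=
    funext fun p => by rw [min_eq_left p.1.2]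
  exact (hmin ▸ hmeas).stronglyMeasurable

lemma measurableSet_inter_floor_eq {τ : Ω → WithTop ℝ≥0} (hτ : IsStoppingTime ℱ τ) {A : Set Ω}
    (hA : MeasurableSet[hτ.measurableSpace] A) (n k : ℕ) :
    MeasurableSet[ℱ ((k + 1) / 2 ^ n)]
      (A ∩ {ω | τ ω < ⊤ ∧ ⌊2 ^ n * (τ ω).untopD 0⌋₊ = k}) := by
  set r : ℝ≥0 := (k + 1) / 2 ^ n with hr
  have hle : (k : ℝ≥0) / 2 ^ n ≤ r := by
    rw [hr]; gcongr; simp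
  have hset : A ∩ {ω | τ ω < ⊤ ∧ ⌊2 ^ n * (τ ω).untopD 0⌋₊ = k}
      = (A ∩ {ω | τ ω ≤ r}) ∩ ({ω | τ ω < r} \ {ω | τ ω < ((k : ℝ≥0) / 2 ^ n : ℝ≥0)}) := by
    ext ω
    simp only [mem_inter_iff, Set.mem_sdiff, mem_ofPred_eq, not_lt]
    induction τ ω with
    | top => exact ⟨fun h => absurd h.2.1 (lt_irrefl _), fun h => absurd h.2.1 not_top_lt⟩
    | coe s =>
      simp only [WithTop.coe_le_coe, WithTop.coe_lt_coe, WithTop.untopD_coe, WithTop.coe_lt_top,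
        true_and, hr]
      rw [Nat.floor_eq_iff (by positivity), lt_div_iff₀ (by positivity),
        div_le_iff₀ (by positivity), le_div_iff₀ (by positivity), mul_comm s]
      grind
  rw [hset]
  exact (hA.2 r).inter ((hτ.measurableSet_lt r).diff (hτ.measurableSet_lt_le hle))

variable [TopologicalSpace S] [MeasurableSpace S] [BorelSpace S]

/-- The Markov property of `X` at deterministic times, with respect to `ℱ` and the transition
kernels `P`. It is tested on bounded continuous functions, which is all that the passage to stopping
times uses, and in integrated form, which avoids conditional expectations. -/
def HasMarkovProperty (μ : Measure Ω) (ℱ : Filtration ℝ≥0 m) (X : ℝ≥0 → Ω → S)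
    (P : ℝ≥0 → Kernel S S) : Prop :=
  ∀ s t A, MeasurableSet[ℱ s] A → ∀ f : S →ᵇ ℝ,
    ∫ ω in A, f (X (s + t) ω) ∂μ = ∫ ω in A, ∫ z, f z ∂(P t (X s ω)) ∂μ

variable {μ : Measure Ω} [IsFiniteMeasure μ] {X : ℝ≥0 → Ω → S} {P : ℝ≥0 → Kernel S S}

omit [TopologicalSpace S] [BorelSpace S] in
lemma norm_integral_kernel_le {κ : Kernel S S} [IsMarkovKernel κ] {f : S → ℝ} {C : ℝ}
    (hC : ∀ x, |f x| ≤ C) (x : S) : ‖∫ z, f z ∂κ x‖ ≤ C := by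
  simpa using norm_integral_le_of_norm_le_const (μ := κ x) (f := f) (.of_forall hC)

/-- A countable-valued stopping time is handled by summing the Markov property over its values. -/
lemma HasMarkovProperty.setIntegral_dyadicAbove (hM : HasMarkovProperty μ ℱ X P)
    (hP : ∀ t, IsMarkovKernel (P t)) (hF : ∀ t (f : S →ᵇ ℝ), Continuous fun x => ∫ z, f z ∂(P t x))
    (hX : ∀ t, Measurable (X t)) {τ : Ω → WithTop ℝ≥0} (hτ : IsStoppingTime ℱ τ) (t : ℝ≥0)
    {A : Set Ω} (hA : MeasurableSet[hτ.measurableSpace] A) (f : S →ᵇ ℝ) (n : ℕ) :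
    ∫ ω in A ∩ {ω | τ ω < ⊤}, f (X (dyadicAbove n ((τ ω).untopD 0) + t) ω) ∂μ
      = ∫ ω in A ∩ {ω | τ ω < ⊤},
          ∫ z, f z ∂(P t (X (dyadicAbove n ((τ ω).untopD 0)) ω)) ∂μ := by
  have hσ : Measurable fun ω => (τ ω).untopD 0 := hτ.measurable'.untopD 0
  let B : ℕ → Set Ω := fun k => A ∩ {ω | τ ω < ⊤ ∧ ⌊2 ^ n * (τ ω).untopD 0⌋₊ = k}
  have hB : ∀ k : ℕ, MeasurableSet[ℱ ((k + 1) / 2 ^ n)] (B k) :=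
    measurableSet_inter_floor_eq hτ hA n
  have hB' : ∀ k, MeasurableSet (B k) := fun k => ℱ.le _ _ (hB k)
  have hU : A ∩ {ω | τ ω < ⊤} = ⋃ k, B k := by
    ext ω; simp [B]
  have hdisj : Pairwise (Function.onFun Disjoint B) := fun k l hkl =>
    Set.disjoint_left.mpr fun ω hk hl => hkl (hk.2.2.symm.trans hl.2.2)
  have hval : ∀ k : ℕ, ∀ ω ∈ B k, dyadicAbove n ((τ ω).untopD 0) = (k + 1) / 2 ^ n :=
    fun k ω hω => by rw [dyadicAbove, hω.2.2]
  rw [hU, integral_iUnion hB' hdisj, integral_iUnion hB' hdisj]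
  · refine tsum_congr fun k => ?_
    rw [setIntegral_congr_fun (g := fun ω => f (X ((k + 1) / 2 ^ n + t) ω)) (hB' k)
        (fun ω hω => by simp only [hval k ω hω]), hM _ _ _ (hB k)]
    exact setIntegral_congr_fun (hB' k) (fun ω hω => by simp only [hval k ω hω])
  · exact Integrable.of_bound (measurable_sample_dyadicAbove
      (X := fun s ω => ∫ z, f z ∂(P t (X s ω))) (fun s => (hF t f).measurable.comp (hX s))
      hσ n).aestronglyMeasurable ‖f‖
      (.of_forall fun _ => norm_integral_kernel_le f.norm_coe_le_norm _)
  · exact Integrable.of_bound (measurable_sample_dyadicAbove (X := fun s ω => f (X (s + t) ω))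
      (fun s => f.continuous.measurable.comp (hX (s + t))) hσ n).aestronglyMeasurable ‖f‖
      (.of_forall fun _ => f.norm_coe_le_norm _)

lemma HasMarkovProperty.setIntegral_stopped (hM : HasMarkovProperty μ ℱ X P)
    (hP : ∀ t, IsMarkovKernel (P t)) (hF : ∀ t (f : S →ᵇ ℝ), Continuous fun x => ∫ z, f z ∂(P t x))
    (hX : ∀ t, Measurable (X t)) (hr : ∀ ω t, ContinuousWithinAt (fun s => X s ω) (Ici t) t)
    {τ : Ω → WithTop ℝ≥0} (hτ : IsStoppingTime ℱ τ) (t : ℝ≥0) {A : Set Ω}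
    (hA : MeasurableSet[hτ.measurableSpace] A) (f : S →ᵇ ℝ) :
    ∫ ω in A ∩ {ω | τ ω < ⊤}, f (X ((τ ω).untopD 0 + t) ω) ∂μ
      = ∫ ω in A ∩ {ω | τ ω < ⊤}, ∫ z, f z ∂(P t (X ((τ ω).untopD 0) ω)) ∂μ := by
  have hσ : Measurable fun ω => (τ ω).untopD 0 := hτ.measurable'.untopD 0
  refine tendsto_nhds_unique
    (tendsto_setIntegral_sample_dyadicAbove (Y := fun s ω => f (X (s + t) ω))
      (fun s => f.continuous.measurable.comp (hX (s + t)))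
      (fun ω s => f.continuous.continuousAt.comp_continuousWithinAt
        (continuousWithinAt_Ici_comp (v := (· + t)) (hr ω (s + t)) (by fun_prop)
          (monotone_id.add_const t)))
      (fun _ _ => f.norm_coe_le_norm _) hσ _) ?_
  simp only [hM.setIntegral_dyadicAbove hP hF hX hτ t hA f]
  exact tendsto_setIntegral_sample_dyadicAbove (Y := fun s ω => ∫ z, f z ∂(P t (X s ω)))
    (fun s => (hF t f).measurable.comp (hX s))
    (fun ω s => (hF t f).continuousAt.comp_continuousWithinAt (hr ω s))
    (fun _ _ => norm_integral_kernel_le f.norm_coe_le_norm _) hσ _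

lemma integral_measure_comp {α β : Type*} [MeasurableSpace α] [MeasurableSpace β] {ν : Measure α}
    {κ : Kernel α β} {F : Type*} [NormedAddCommGroup F] [NormedSpace ℝ F] {f : β → F}
    (hf : Integrable f (κ ∘ₘ ν)) :
    ∫ y, f y ∂(κ ∘ₘ ν) = ∫ x, ∫ y, f y ∂κ x ∂ν := by
  rw [Measure.comp_eq_comp_const_apply] at hf ⊢
  rw [Kernel.integral_comp hf, Kernel.const_apply]

variable [TopologicalSpace.PseudoMetrizableSpace S]

lemma HasMarkovProperty.map_stopped (hM : HasMarkovProperty μ ℱ X P)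
    (hP : ∀ t, IsMarkovKernel (P t)) (hF : ∀ t (f : S →ᵇ ℝ), Continuous fun x => ∫ z, f z ∂(P t x))
    (hX : ∀ t, Measurable (X t)) (hr : ∀ ω t, ContinuousWithinAt (fun s => X s ω) (Ici t) t)
    {τ : Ω → WithTop ℝ≥0} (hτ : IsStoppingTime ℱ τ) (t : ℝ≥0) {A : Set Ω}
    (hA : MeasurableSet[hτ.measurableSpace] A) :
    (μ.restrict (A ∩ {ω | τ ω < ⊤})).map (fun ω => X ((τ ω).untopD 0 + t) ω)
      = P t ∘ₘ (μ.restrict (A ∩ {ω | τ ω < ⊤})).map fun ω => X ((τ ω).untopD 0) ω := by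
  have hσ : Measurable fun ω => (τ ω).untopD 0 := hτ.measurable'.untopD 0
  have hXt := measurable_sample_of_rightContinuous hX hr (hσ.add_const t)
  have hX0 := measurable_sample_of_rightContinuous hX hr hσ
  refine ext_of_forall_integral_eq_of_IsFiniteMeasure fun g => ?_
  rw [integral_map hXt.aemeasurable g.continuous.measurable.aestronglyMeasurable,
    integral_measure_comp (g.integrable _), integral_map hX0.aemeasurable
      (hF t g).measurable.aestronglyMeasurable]
  exact hM.setIntegral_stopped hP hF hX hr hτ t hA g

lemma measurable_indicator_comp_stopped [SecondCountableTopology S]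
    (hX : ∀ t, Measurable[ℱ t] (X t)) (hr : ∀ ω t, ContinuousWithinAt (fun s => X s ω) (Ici t) t)
    {τ : Ω → WithTop ℝ≥0} (hτ : IsStoppingTime ℱ τ) {g : S → ℝ} (hg : Measurable g) :
    Measurable[hτ.measurableSpace]
      ({ω | τ ω < ⊤}.indicator fun ω => g (X ((τ ω).untopD 0) ω)) := by
  have hstopped : Measurable[hτ.measurableSpace] (stoppedValue X τ) :=
    measurable_stoppedValue (isStronglyProgressive_of_rightContinuous hX hr) hτ
  have hlt : MeasurableSet[hτ.measurableSpace] {ω | τ ω < ⊤} :=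
    hτ.measurable (measurableSet_Iio (a := (⊤ : WithTop ℝ≥0)))
  convert (hg.comp hstopped).indicator hlt using 1
  refine indicator_congr fun ω hω => ?_
  simp only [Function.comp, stoppedValue]
  lift τ ω to ℝ≥0 using (show τ ω < ⊤ from hω).ne with s
  rfl

theorem isStrongMarkov_of_feller [SecondCountableTopology S] (hP : ∀ t, IsMarkovKernel (P t))
    (hF : ∀ t (f : S →ᵇ ℝ), Continuous fun x => ∫ z, f z ∂(P t x))
    (hX : ∀ t, Measurable[ℱ t] (X t))
    (hr : ∀ ω t, ContinuousWithinAt (fun s => X s ω) (Ici t) t)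
    (hM : HasMarkovProperty μ ℱ X P) :
    IsStrongMarkov μ ℱ X P := by
  refine ⟨hX, fun τ hτ t f hf ⟨C, hC⟩ => ?_⟩
  have hX' : ∀ t, Measurable (X t) := fun t => (hX t).mono (ℱ.le t) le_rfl
  have hσ : Measurable fun ω => (τ ω).untopD 0 := hτ.measurable'.untopD 0
  have hXt := measurable_sample_of_rightContinuous hX' hr (hσ.add_const t)
  have hX0 := measurable_sample_of_rightContinuous hX' hr hσ
  have hlt : MeasurableSet {ω | τ ω < ⊤} :=
    hτ.measurable' (measurableSet_Iio (a := (⊤ : WithTop ℝ≥0)))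
  have hg : StronglyMeasurable fun x => ∫ z, f z ∂(P t x) :=
    (hf.comp measurable_snd).stronglyMeasurable.integral_kernel_prod_right' (κ := P t)
  refine (ae_eq_condExp_of_forall_setIntegral_eq hτ.measurableSpace_le ?_ (fun A _ _ => ?_)
    (fun A hA _ => ?_) ?_).symm
  · exact (Integrable.of_bound (hf.comp hXt).aestronglyMeasurable C
      (.of_forall fun ω => hC _)).indicator hlt
  · exact ((Integrable.of_bound (hg.comp_measurable hX0).aestronglyMeasurable C
      (.of_forall fun ω => norm_integral_kernel_le hC _)).indicator hlt).integrableOn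
  · rw [setIntegral_indicator hlt, setIntegral_indicator hlt,
      ← integral_map (f := f) hXt.aemeasurable hf.aestronglyMeasurable,
      hM.map_stopped hP hF hX' hr hτ t hA,
      integral_measure_comp (Integrable.of_bound hf.aestronglyMeasurable C (.of_forall hC)),
      integral_map hX0.aemeasurable hg.aestronglyMeasurable]
  · exact (measurable_indicator_comp_stopped hX hr hτ
      hg.measurable).stronglyMeasurable.aestronglyMeasurable

end StrongMarkov

/-! ### The flow, the survival function and the law of a waiting time -/

/-- The deterministic motion between two switches: the state reached from `e` after time `t`. -/
noncomputable def flow (a t : ℝ) (e : E) : E := (e.1 + a * sgn e.2 * t, e.2)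

/-- The state reached from `e` by following the flow up to time `t` and switching there. -/
noncomputable def jump (a t : ℝ) (e : E) : E := (e.1 + a * sgn e.2 * t, -e.2)

lemma continuous_sgn : Continuous sgn := continuous_of_discreteTopology

lemma sgn_mul_self (j : ℤˣ) : sgn j * sgn j = 1 := by
  rcases Int.units_eq_one_or j with rfl | rfl <;> simp [sgn]

lemma abs_sgn (j : ℤˣ) : |sgn j| = 1 := by
  rcases Int.units_eq_one_or j with rfl | rfl <;> simp [sgn]

lemma continuous_flow (a : ℝ) : Continuous fun p : ℝ × E => flow a p.1 p.2 := by
  have := continuous_sgn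
  unfold flow
  fun_prop

lemma continuous_jump (a : ℝ) : Continuous fun p : ℝ × E => jump a p.1 p.2 := by
  have := continuous_sgn
  have : Continuous fun j : ℤˣ => -j := continuous_of_discreteTopology
  unfold jump
  fun_prop

lemma continuous_flow_left (a : ℝ) (e : E) : Continuous fun t => flow a t e :=
  (continuous_flow a).comp (Continuous.prodMk_left e)

@[simp] lemma flow_zero (a : ℝ) (e : E) : flow a 0 e = e := by simp [flow]

lemma flow_flow (a s t : ℝ) (e : E) : flow a t (flow a s e) = flow a (s + t) e := by
  simp only [flow, Prod.mk.injEq, and_true]; ring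

lemma jump_flow (a s t : ℝ) (e : E) : jump a t (flow a s e) = jump a (s + t) e := by
  simp only [flow, jump, Prod.mk.injEq, and_true]; ring

section Survival

variable {a : ℝ} {lam : E → ℝ}

lemma survival_eq (a : ℝ) (lam : E → ℝ) (t : ℝ) (e : E) :
    survival a lam t e = Real.exp (-∫ s in (0 : ℝ)..t, lam (flow a s e)) := rfl

lemma survival_pos (t : ℝ) (e : E) : 0 < survival a lam t e := Real.exp_pos _

@[simp] lemma survival_zero (e : E) : survival a lam 0 e = 1 := by simp [survival]

lemma survival_le_one (hlam : ∀ x, 0 ≤ lam x) {t : ℝ} (ht : 0 ≤ t) (e : E) :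
    survival a lam t e ≤ 1 :=
  Real.exp_le_one_iff.mpr (neg_nonpos.mpr
    (intervalIntegral.integral_nonneg ht fun _ _ => hlam _))

lemma continuous_survival (hlam : Continuous lam) :
    Continuous fun p : ℝ × E => survival a lam p.1 p.2 := by
  refine Real.continuous_exp.comp (Continuous.neg ?_)
  refine intervalIntegral.continuous_parametric_intervalIntegral_of_continuous
    (f := fun (p : ℝ × E) s => lam (flow a s p.2)) ?_ continuous_fst
  exact hlam.comp ((continuous_flow a).comp
    (by fun_prop : Continuous fun q : (ℝ × E) × ℝ => (q.2, q.1.2)))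

lemma survival_add (hlam : Continuous lam) (s t : ℝ) (e : E) :
    survival a lam (s + t) e = survival a lam s e * survival a lam t (flow a s e) := by
  have hi : ∀ x y, IntervalIntegrable (fun s => lam (flow a s e)) volume x y :=
    (hlam.comp (continuous_flow_left a e)).intervalIntegrable
  rw [survival_eq, survival_eq, survival_eq, ← Real.exp_add,
    ← intervalIntegral.integral_add_adjacent_intervals (hi 0 s) (hi s (s + t))]
  simp only [flow_flow]
  rw [intervalIntegral.integral_comp_add_left (fun r => lam (flow a r e)), neg_add, add_zero]

lemma hasDerivAt_survival (hlam : Continuous lam) (t : ℝ) (e : E) :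
    HasDerivAt (fun t => survival a lam t e) (-(lam (flow a t e) * survival a lam t e)) t := by
  have h1 := ((hlam.comp (continuous_flow_left a e)).integral_hasStrictDerivAt 0 t).hasDerivAt
  refine h1.neg.exp.congr_deriv ?_
  simp only [survival_eq, Pi.neg_apply, Function.comp_def]
  ring

lemma tendsto_survival_of_eventually_le (hlam : Continuous lam) {c : ℝ} (hc : 0 < c) {e : E}
    (hle : ∀ᶠ s in atTop, c ≤ lam (flow a s e)) :
    Tendsto (fun t => survival a lam t e) atTop (𝓝 0) := by
  obtain ⟨s₀, hs₀⟩ := eventually_atTop.mp hle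
  have hi : ∀ x y, IntervalIntegrable (fun s => lam (flow a s e)) volume x y :=
    (hlam.comp (continuous_flow_left a e)).intervalIntegrable
  refine Real.tendsto_exp_neg_atTop_nhds_zero.comp (tendsto_atTop_mono' atTop
    (f₁ := fun t => (∫ s in (0 : ℝ)..s₀, lam (flow a s e)) + (t - s₀) * c) ?_ ?_)
  · filter_upwards [eventually_ge_atTop s₀] with t ht
    calc (∫ s in (0 : ℝ)..s₀, lam (flow a s e)) + (t - s₀) * c
        = (∫ s in (0 : ℝ)..s₀, lam (flow a s e)) + ∫ _ in s₀..t, c := by simp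
      _ ≤ (∫ s in (0 : ℝ)..s₀, lam (flow a s e)) + ∫ s in s₀..t, lam (flow a s e) := by
          gcongr
          exact intervalIntegral.integral_mono_on ht (by simp) (hi _ _) fun s hs => hs₀ s hs.1
      _ = _ := intervalIntegral.integral_add_adjacent_intervals (hi _ _) (hi _ _)
  · exact tendsto_atTop_add_const_left _ _
      ((tendsto_atTop_add_const_right _ _ tendsto_id).atTop_mul_const hc)

lemma eventually_le_sgn_mul_flow (ha : 0 < a) (y₀ : ℝ) (e : E) :
    ∀ᶠ s in atTop, y₀ ≤ sgn e.2 * (flow a s e).1 := by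
  filter_upwards [eventually_ge_atTop ((y₀ - sgn e.2 * e.1) / a)] with s hs
  rw [div_le_iff₀ ha] at hs
  calc y₀ ≤ sgn e.2 * e.1 + (sgn e.2 * sgn e.2) * (s * a) := by rw [sgn_mul_self]; linarith
    _ = sgn e.2 * (flow a s e).1 := by simp only [flow]; ring

/-- The assumptions on the switching rate under which the zig-zag process is constructed. The last
one says that every waiting time is almost surely finite. -/
structure IsAdmissible (a : ℝ) (lam : E → ℝ) : Prop where
  continuous : Continuous lam
  nonneg : ∀ x, 0 ≤ lam x
  tendsto_survival : ∀ e, Tendsto (fun t => survival a lam t e) atTop (𝓝 0)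

/-- The density of the first waiting time. -/
noncomputable def waitDensity (a : ℝ) (lam : E → ℝ) (e : E) (s : ℝ) : ℝ :=
  lam (flow a s e) * survival a lam s e

lemma waitDensity_nonneg (hlam : ∀ x, 0 ≤ lam x) (e : E) (s : ℝ) : 0 ≤ waitDensity a lam e s :=
  mul_nonneg (hlam _) (survival_pos _ _).le

lemma continuous_waitDensity (hlam : Continuous lam) :
    Continuous fun p : E × ℝ => waitDensity a lam p.1 p.2 :=
  (hlam.comp ((continuous_flow a).comp continuous_swap)).mul
    ((continuous_survival hlam).comp continuous_swap)

lemma waitDensity_add (hlam : Continuous lam) (s t : ℝ) (e : E) :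
    waitDensity a lam e (s + t) = survival a lam s e * waitDensity a lam (flow a s e) t := by
  rw [waitDensity, waitDensity, survival_add hlam, flow_flow]; ring

lemma IsAdmissible.lintegral_waitDensity_Ioi (h : IsAdmissible a lam) (t : ℝ) (e : E) :
    ∫⁻ s in Ioi t, ENNReal.ofReal (waitDensity a lam e s)
      = ENNReal.ofReal (survival a lam t e) := by
  have hd : ∀ x ∈ Ici t, HasDerivAt (fun t => -survival a lam t e) (waitDensity a lam e x) x :=
    fun x _ => (hasDerivAt_survival h.continuous x e).neg.congr_deriv (neg_neg _)
  have hlim : Tendsto (fun t => -survival a lam t e) atTop (𝓝 0) := by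
    simpa using (h.tendsto_survival e).neg
  have hnonneg := waitDensity_nonneg (a := a) h.nonneg e
  have hint := integrableOn_Ioi_deriv_of_nonneg' hd (fun x _ => hnonneg x) hlim
  rw [← ofReal_integral_eq_lintegral_ofReal hint (.of_forall hnonneg),
    integral_Ioi_of_hasDerivAt_of_tendsto' hd hint hlim, sub_neg_eq_add, zero_add]

end Survival

section WaitKernel

variable {a : ℝ} {lam : E → ℝ}

instance : SigmaFinite ((volume : Measure ℝ).comap ((↑) : Ioi (0 : ℝ) → ℝ)) := by
  refine SigmaFinite.of_map _ measurable_subtype_coe.aemeasurable ?_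
  rw [(MeasurableEmbedding.subtype_coe measurableSet_Ioi).map_comap]
  infer_instance

/-- The law of the first waiting time, as a function of the initial state. -/
noncomputable def waitKernel (a : ℝ) (lam : E → ℝ) : Kernel E (Ioi (0 : ℝ)) :=
  (Kernel.const E ((volume : Measure ℝ).comap ((↑) : Ioi (0 : ℝ) → ℝ))).withDensity
    fun e z => ENNReal.ofReal (waitDensity a lam e z)

lemma lintegral_waitKernel (hlam : Continuous lam) (e : E) {H : ℝ → ENNReal} (hH : Measurable H) :
    ∫⁻ z, H z ∂(waitKernel a lam e)
      = ∫⁻ s in Ioi (0 : ℝ), ENNReal.ofReal (waitDensity a lam e s) * H s := by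
  have hdens : Measurable (Function.uncurry fun (e : E) (z : Ioi (0 : ℝ)) =>
      ENNReal.ofReal (waitDensity a lam e z)) :=
    ((continuous_waitDensity hlam).measurable.comp
      (measurable_fst.prodMk (measurable_subtype_coe.comp measurable_snd))).ennreal_ofReal
  rw [waitKernel, Kernel.lintegral_withDensity _ hdens _
    (g := fun z : Ioi (0 : ℝ) => H z) (hH.comp measurable_subtype_coe), Kernel.const_apply]
  exact lintegral_subtype_comap measurableSet_Ioi
    (fun s => ENNReal.ofReal (waitDensity a lam e s) * H s)

lemma setLIntegral_waitKernel_Ioi (hlam : Continuous lam) {s : ℝ} (hs : 0 ≤ s) (e : E)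
    {H : ℝ → ENNReal} (hH : Measurable H) :
    ∫⁻ z in {z : Ioi (0 : ℝ) | s < z}, H z ∂(waitKernel a lam e)
      = ∫⁻ r in Ioi s, ENNReal.ofReal (waitDensity a lam e r) * H r := by
  have hm : MeasurableSet {z : Ioi (0 : ℝ) | s < z} :=
    measurable_subtype_coe measurableSet_Ioi
  calc ∫⁻ z in {z : Ioi (0 : ℝ) | s < z}, H z ∂(waitKernel a lam e)
      = ∫⁻ z, (Ioi s).indicator H z ∂(waitKernel a lam e) := (lintegral_indicator hm _).symm
    _ = ∫⁻ r in Ioi (0 : ℝ),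
          (Ioi s).indicator (fun r => ENNReal.ofReal (waitDensity a lam e r) * H r) r := by
        rw [lintegral_waitKernel hlam e (hH.indicator measurableSet_Ioi)]
        simp only [indicator_apply, mul_ite, mul_zero]
    _ = _ := by
        rw [setLIntegral_indicator measurableSet_Ioi, inter_eq_left.mpr (Ioi_subset_Ioi hs)]

/-- The waiting times are memoryless along the flow. -/
lemma setLIntegral_waitKernel_Ioi_sub (hlam : Continuous lam) {s : ℝ} (hs : 0 ≤ s) (e : E)
    {H : ℝ → ENNReal} (hH : Measurable H) :
    ∫⁻ z in {z : Ioi (0 : ℝ) | s < z}, H (z - s) ∂(waitKernel a lam e)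
      = ENNReal.ofReal (survival a lam s e) * ∫⁻ z, H z ∂(waitKernel a lam (flow a s e)) := by
  rw [setLIntegral_waitKernel_Ioi hlam hs e (H := fun z => H (z - s))
      (hH.comp (measurable_id.sub_const s)), lintegral_waitKernel hlam _ hH,
    ← lintegral_const_mul' _ _ ENNReal.ofReal_ne_top,
    ← lintegral_indicator measurableSet_Ioi, ← lintegral_indicator measurableSet_Ioi,
    ← lintegral_add_left_eq_self _ s]
  refine lintegral_congr fun r => ?_
  simp only [indicator_apply, mem_Ioi, waitDensity_add hlam, add_sub_cancel_left,
    lt_add_iff_pos_right, ENNReal.ofReal_mul (survival_pos s e).le, mul_assoc]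

namespace IsAdmissible

variable (h : IsAdmissible a lam)
include h

lemma waitKernel_Ioi {t : ℝ} (ht : 0 ≤ t) (e : E) :
    waitKernel a lam e {z | t < (z : ℝ)} = ENNReal.ofReal (survival a lam t e) := by
  rw [← setLIntegral_one, setLIntegral_waitKernel_Ioi h.continuous ht e measurable_const]
  simp only [mul_one, h.lintegral_waitDensity_Ioi]

lemma isMarkovKernel_waitKernel : IsMarkovKernel (waitKernel a lam) := by
  refine ⟨fun e => ⟨?_⟩⟩
  have huniv : {z : Ioi (0 : ℝ) | (0 : ℝ) < z} = univ := eq_univ_of_forall fun z => z.2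
  rw [← huniv, h.waitKernel_Ioi le_rfl, survival_zero, ENNReal.ofReal_one]

end IsAdmissible

end WaitKernel

/-! ### The law of the sequence of waiting times -/

section SeqCons

variable {X : Type*}

/-- The sequence `x, u 0, u 1, …`. -/
def seqCons (x : X) (u : ℕ → X) : ℕ → X
  | 0 => x
  | n + 1 => u n

@[simp] lemma seqCons_zero (x : X) (u : ℕ → X) : seqCons x u 0 = x := rfl

@[simp] lemma seqCons_succ (x : X) (u : ℕ → X) (n : ℕ) : seqCons x u (n + 1) = u n := rfl

lemma preimage_seqCons_pi_range (N : ℕ) (t : ℕ → Set X) :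
    (fun p : X × (ℕ → X) => seqCons p.1 p.2) ⁻¹' Set.pi (Finset.range (N + 1)) t
      = t 0 ×ˢ Set.pi (Finset.range N) fun n => t (n + 1) := by
  ext ⟨x, u⟩
  simp only [Finset.coe_range, mem_preimage, Set.mem_pi, mem_Iio, mem_prod,
    Nat.forall_lt_succ_left, seqCons_zero, seqCons_succ]

variable [MeasurableSpace X]

lemma measurable_seqCons : Measurable fun p : X × (ℕ → X) => seqCons p.1 p.2 := by
  refine measurable_pi_lambda _ fun n => ?_
  cases n with
  | zero => exact measurable_fst
  | succ n => exact (measurable_pi_apply n).comp measurable_snd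

lemma map_seqCons_infinitePi (ν : Measure X) [IsProbabilityMeasure ν] :
    (ν.prod (Measure.infinitePi fun _ : ℕ => ν)).map (fun p => seqCons p.1 p.2)
      = Measure.infinitePi fun _ : ℕ => ν := by
  classical
  refine Measure.eq_infinitePi _ fun s t ht => ?_
  obtain ⟨N, hN⟩ := s.exists_nat_subset_range
  have hsN : s ⊆ Finset.range (N + 1) := hN.trans (Finset.range_mono N.le_succ)
  let t' : ℕ → Set X := fun i => if i ∈ s then t i else univ
  have ht' : ∀ i, MeasurableSet (t' i) := fun i => by
    simp only [t']; split_ifs <;> simp [ht]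
  have hpi : Set.pi s t = Set.pi (Finset.range (N + 1)) t' := by
    ext u
    simp only [Set.mem_pi, t']
    exact ⟨fun h i _ => by split_ifs with hi <;> simp [h, hi],
      fun h i hi => by simpa [Finset.mem_coe.mp hi] using h i (hsN hi)⟩
  have hprod : ∏ i ∈ s, ν (t i) = ∏ i ∈ Finset.range (N + 1), ν (t' i) := by
    rw [← Finset.prod_subset hsN fun i _ hi => by simp [t', hi]]
    exact Finset.prod_congr rfl fun i hi => by simp [t', hi]
  rw [hpi, hprod, Measure.map_apply measurable_seqCons
      (MeasurableSet.pi (Finset.countable_toSet _) fun i _ => ht' i),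
    preimage_seqCons_pi_range, Measure.prod_prod, Measure.infinitePi_pi _ fun i _ => ht' _,
    Finset.prod_range_succ', mul_comm]

end SeqCons

section Sampled

variable {a : ℝ} {I : Type*} {G : E → I → Ioi (0 : ℝ)}

/-- The state after `n` switches, if the waiting time in the state `x` is sampled as `G x (u i)`
with randomness `u`. -/
noncomputable def sampledState (a : ℝ) (G : E → I → Ioi (0 : ℝ)) (e : E) (u : ℕ → I) : ℕ → E
  | 0 => e
  | n + 1 => jump a (G (sampledState a G e u n) (u n)) (sampledState a G e u n)

/-- The waiting times between the switches of `sampledState`. -/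
noncomputable def sampledTimes (a : ℝ) (G : E → I → Ioi (0 : ℝ)) (e : E) (u : ℕ → I) (n : ℕ) :
    Ioi (0 : ℝ) :=
  G (sampledState a G e u n) (u n)

lemma sampledState_seqCons (e : E) (x : I) (u : ℕ → I) (n : ℕ) :
    sampledState a G e (seqCons x u) (n + 1) = sampledState a G (jump a (G e x) e) u n := by
  induction n with
  | zero => rfl
  | succ n ih => rw [sampledState, ih]; rfl

lemma sampledTimes_seqCons (e : E) (x : I) (u : ℕ → I) :
    sampledTimes a G e (seqCons x u)
      = seqCons (G e x) (sampledTimes a G (jump a (G e x) e) u) := by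
  funext n
  cases n with
  | zero => rfl
  | succ n => simp only [sampledTimes, sampledState_seqCons, seqCons_succ]

lemma measurable_sampledTimes [MeasurableSpace I] (hG : Measurable (Function.uncurry G)) :
    Measurable fun p : E × (ℕ → I) => sampledTimes a G p.1 p.2 := by
  have hu : ∀ n, Measurable fun p : E × (ℕ → I) => p.2 n := fun n =>
    (measurable_pi_apply n).comp measurable_snd
  have hs : ∀ n, Measurable fun p : E × (ℕ → I) => sampledState a G p.1 p.2 n := fun n => by
    induction n with
    | zero => exact measurable_fst
    | succ n ih =>
      exact (continuous_jump a).measurable.comp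
        ((measurable_subtype_coe.comp (hG.comp (ih.prodMk (hu n)))).prodMk ih)
  exact measurable_pi_lambda _ fun n => hG.comp ((hs n).prodMk (hu n))

end Sampled

lemma measurable_jump_coe (a : ℝ) (e : E) : Measurable fun x : Ioi (0 : ℝ) => jump a x e :=
  (continuous_jump a).measurable.comp (measurable_subtype_coe.prodMk measurable_const)

namespace IsAdmissible

variable {a : ℝ} {lam : E → ℝ} (h : IsAdmissible a lam)

include h in
open unitInterval in
lemma exists_sampler :
    ∃ G : E → I → Ioi (0 : ℝ), Measurable (Function.uncurry G) ∧
      ∀ e, volume.map (G e) = waitKernel a lam e := by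
  have := h.isMarkovKernel_waitKernel
  have : Nonempty (Ioi (0 : ℝ)) := ⟨⟨1, mem_Ioi.mpr one_pos⟩⟩
  have : StandardBorelSpace (Ioi (0 : ℝ)) := measurableSet_Ioi.standardBorel
  exact Kernel.exists_measurable_map_eq_unitInterval (waitKernel a lam)

/-- A map that samples the first waiting time from a uniform random variable. -/
noncomputable def sampler : E → unitInterval → Ioi (0 : ℝ) := h.exists_sampler.choose

lemma measurable_sampler : Measurable (Function.uncurry h.sampler) :=
  h.exists_sampler.choose_spec.1

lemma map_sampler (e : E) : volume.map (h.sampler e) = waitKernel a lam e :=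
  h.exists_sampler.choose_spec.2 e

/-- The law of the waiting times, as a function of the initial state. It is realized on sequences of
independent uniform random variables, so that its measurability in the state is that of the
sampled waiting times. -/
noncomputable def seqKernel : Kernel E (ℕ → Ioi (0 : ℝ)) :=
  (Kernel.id ×ₖ
    Kernel.const E (Measure.infinitePi fun _ : ℕ => (volume : Measure unitInterval))).map
    fun p => sampledTimes a h.sampler p.1 p.2

instance : IsMarkovKernel h.seqKernel :=
  Kernel.IsMarkovKernel.map _ (measurable_sampledTimes h.measurable_sampler)

lemma seqKernel_apply (e : E) :
    h.seqKernel e = (Measure.infinitePi fun _ : ℕ => (volume : Measure unitInterval)).map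
      (sampledTimes a h.sampler e) := by
  have hm := measurable_sampledTimes (a := a) h.measurable_sampler
  rw [seqKernel, Kernel.map_apply _ hm, Kernel.prod_apply, Kernel.id_apply, Kernel.const_apply,
    Measure.dirac_prod, Measure.map_map hm measurable_prodMk_left]
  rfl

lemma measurable_lintegral_seqCons (e : E) {H : (ℕ → Ioi (0 : ℝ)) → ENNReal} (hH : Measurable H) :
    Measurable fun x : Ioi (0 : ℝ) => ∫⁻ z, H (seqCons x z) ∂(h.seqKernel (jump a x e)) := by
  have := Measurable.lintegral_kernel_prod_right'
    (κ := h.seqKernel.comap _ (measurable_jump_coe a e))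
    (f := fun p => H (seqCons p.1 p.2)) (hH.comp measurable_seqCons)
  simpa only [Kernel.comap_apply] using this

lemma lintegral_seqKernel (e : E) {H : (ℕ → Ioi (0 : ℝ)) → ENNReal} (hH : Measurable H) :
    ∫⁻ z, H z ∂(h.seqKernel e)
      = ∫⁻ x, ∫⁻ z, H (seqCons x z) ∂(h.seqKernel (jump a x e)) ∂(waitKernel a lam e) := by
  have hsampled : ∀ e, Measurable (sampledTimes a h.sampler e) := fun e =>
    (measurable_sampledTimes h.measurable_sampler).comp measurable_prodMk_left
  have hsampler : Measurable (h.sampler e) := h.measurable_sampler.comp measurable_prodMk_left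
  have hHs : Measurable fun u => H (sampledTimes a h.sampler e u) := hH.comp (hsampled e)
  rw [← h.map_sampler e, lintegral_map (h.measurable_lintegral_seqCons e hH) hsampler,
    h.seqKernel_apply, lintegral_map hH (hsampled e), ← map_seqCons_infinitePi,
    lintegral_map hHs measurable_seqCons,
    lintegral_prod (fun p : unitInterval × (ℕ → unitInterval) =>
      H (sampledTimes a h.sampler e (seqCons p.1 p.2))) (hHs.comp measurable_seqCons).aemeasurable]
  refine lintegral_congr fun x => ?_
  have hHx : Measurable fun z => H (seqCons (h.sampler e x) z) :=
    hH.comp (measurable_seqCons.comp measurable_prodMk_left)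
  rw [h.seqKernel_apply, lintegral_map hHx (hsampled _)]
  simp only [sampledTimes_seqCons]

lemma setLIntegral_seqKernel (e : E) {A : Set (ℕ → Ioi (0 : ℝ))} (hA : MeasurableSet A)
    {H : (ℕ → Ioi (0 : ℝ)) → ENNReal} (hH : Measurable H) :
    ∫⁻ z in A, H z ∂(h.seqKernel e)
      = ∫⁻ x, ∫⁻ z in {z | seqCons x z ∈ A}, H (seqCons x z) ∂(h.seqKernel (jump a x e))
          ∂(waitKernel a lam e) := by
  rw [← lintegral_indicator hA, h.lintegral_seqKernel e (hH.indicator hA)]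
  refine lintegral_congr fun x => ?_
  exact lintegral_indicator (measurable_seqCons.comp measurable_prodMk_left hA)
    fun z => H (seqCons x z)

lemma seqKernel_eq_map (e : E) :
    h.seqKernel e = (waitKernel a lam e ⊗ₘ h.seqKernel.comap _ (measurable_jump_coe a e)).map
      (fun p => seqCons p.1 p.2) := by
  have := h.isMarkovKernel_waitKernel
  refine Measure.ext_of_lintegral _ fun H hH => ?_
  rw [h.lintegral_seqKernel e hH, lintegral_map hH measurable_seqCons,
    Measure.lintegral_compProd (f := fun p => H (seqCons p.1 p.2)) (hH.comp measurable_seqCons)]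
  rfl

lemma integral_seqKernel (e : E) {H : (ℕ → Ioi (0 : ℝ)) → ℝ} (hH : Measurable H)
    {C : ℝ} (hC : ∀ z, |H z| ≤ C) :
    ∫ z, H z ∂(h.seqKernel e)
      = ∫ x, ∫ z, H (seqCons x z) ∂(h.seqKernel (jump a x e)) ∂(waitKernel a lam e) := by
  have := h.isMarkovKernel_waitKernel
  rw [h.seqKernel_eq_map e, integral_map measurable_seqCons.aemeasurable hH.aestronglyMeasurable,
    Measure.integral_compProd (f := fun p => H (seqCons p.1 p.2)) (Integrable.of_bound
      (hH.comp measurable_seqCons).aestronglyMeasurable C (.of_forall fun _ => hC _))]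
  rfl

end IsAdmissible

/-! ### Elementary properties of the paths -/

section Path

variable {a : ℝ} {e : E} {z z' : ℕ → Ioi (0 : ℝ)} {t : ℝ≥0} {n : ℕ}

@[simp] lemma switchTime_zero : switchTime z 0 = 0 := by simp [switchTime]

lemma switchTime_succ : switchTime z (n + 1) = switchTime z n + z n := by
  simp [switchTime, Finset.sum_range_succ]

lemma strictMono_switchTime : StrictMono (switchTime z) :=
  strictMono_nat_of_lt_succ fun n => by
    rw [switchTime_succ]; exact lt_add_of_pos_right _ (z n).2

lemma switchTime_nonneg : 0 ≤ switchTime z n := by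
  rw [← switchTime_zero (z := z)]; exact strictMono_switchTime.monotone (Nat.zero_le n)

lemma switchTime_seqCons (x : Ioi (0 : ℝ)) :
    switchTime (seqCons x z) (n + 1) = x + switchTime z n := by
  simp [switchTime, Finset.sum_range_succ', add_comm]

lemma switchTime_congr (hz : ∀ i < n, z i = z' i) : switchTime z n = switchTime z' n :=
  Finset.sum_congr rfl fun i hi => by rw [hz i (Finset.mem_range.mp hi)]

lemma skeleton_succ : skeleton a e z (n + 1) = jump a (z n) (skeleton a e z n) := rfl

lemma skeleton_congr (hz : ∀ i < n, z i = z' i) : skeleton a e z n = skeleton a e z' n := by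
  induction n with
  | zero => rfl
  | succ n ih => rw [skeleton_succ, skeleton_succ, ih fun i hi => hz i (by lia), hz n (by lia)]

lemma skeleton_seqCons (x : Ioi (0 : ℝ)) :
    skeleton a e (seqCons x z) (n + 1) = skeleton a (jump a x e) z n := by
  induction n with
  | zero => rfl
  | succ n ih => rw [skeleton_succ, ih]; rfl

/-- The set of the sequences of waiting times with exactly `n` switches up to time `t`. -/
def switchCountSet (n : ℕ) (t : ℝ≥0) : Set (ℕ → Ioi (0 : ℝ)) :=
  {z | switchTime z n ≤ t ∧ (t : ℝ) < switchTime z (n + 1)}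

lemma measurableSet_switchCountSet (n : ℕ) (t : ℝ≥0) : MeasurableSet (switchCountSet n t) :=
  (measurableSet_le (measurable_switchTime n) measurable_const).inter
    (measurableSet_lt measurable_const (measurable_switchTime (n + 1)))

lemma switchCount_eq (h : z ∈ switchCountSet n t) : switchCount z t = n := by
  refine le_antisymm (csSup_le ⟨n, h.1⟩ fun k hk => ?_)
    (le_csSup ⟨n, fun k hk => ?_⟩ h.1)
  all_goals
    have := strictMono_switchTime.lt_iff_lt.mp ((show switchTime z k ≤ t from hk).trans_lt h.2)
    lia

lemma switchCount_eq_zero (h : ∀ n, switchTime z n ≤ t) : switchCount z t = 0 := by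
  refine Nat.sSup_of_not_bddAbove fun ⟨N, hN⟩ => ?_
  have := hN (h (N + 1))
  lia

lemma disjoint_switchCountSet (t : ℝ≥0) :
    Pairwise (Function.onFun Disjoint fun n => switchCountSet n t) := fun _ _ hkl =>
  Set.disjoint_left.mpr fun _ hk hl => hkl ((switchCount_eq hk).symm.trans (switchCount_eq hl))

lemma exists_mem_switchCountSet (h : (t : ℝ) < switchTime z n) :
    ∃ k, z ∈ switchCountSet k t := by
  classical
  have hex : ∃ n, (t : ℝ) < switchTime z n := ⟨n, h⟩
  have hpos : Nat.find hex ≠ 0 := fun h0 => by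
    have := Nat.find_spec hex
    rw [h0, switchTime_zero] at this
    exact absurd this (not_lt.mpr t.2)
  obtain ⟨k, hk⟩ := Nat.exists_eq_succ_of_ne_zero hpos
  refine ⟨k, not_lt.mp (Nat.find_min hex (by lia)), ?_⟩
  simpa only [hk] using Nat.find_spec hex

lemma exists_mem_switchCountSet_or_explosion (z : ℕ → Ioi (0 : ℝ)) (t : ℝ≥0) :
    (∃ n, z ∈ switchCountSet n t) ∨ ∀ n, switchTime z n ≤ t := by
  by_contra! hc
  obtain ⟨h, n, hn⟩ := hc
  obtain ⟨k, hk⟩ := exists_mem_switchCountSet hn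
  exact h k hk

lemma switchTime_switchCount_le (z : ℕ → Ioi (0 : ℝ)) (t : ℝ≥0) :
    switchTime z (switchCount z t) ≤ t := by
  rcases exists_mem_switchCountSet_or_explosion z t with ⟨k, hk⟩ | hle
  · rw [switchCount_eq hk]; exact hk.1
  · exact hle _

lemma path_eq (h : z ∈ switchCountSet n t) :
    path a e z t = flow a (t - switchTime z n) (skeleton a e z n) := by
  rw [path, switchCount_eq h]; rfl

lemma path_eq_of_explosion (h : ∀ n, switchTime z n ≤ t) : path a e z t = flow a t e := by
  rw [path, switchCount_eq_zero h, switchTime_zero, sub_zero]; rfl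

lemma path_eq_flow (h : (t : ℝ) < z 0) : path a e z t = flow a t e := by
  rw [path_eq (n := 0) ⟨by simp, by simpa [switchTime_succ] using h⟩, switchTime_zero, sub_zero]
  rfl

@[simp] lemma path_zero : path a e z 0 = e := by
  rw [path_eq_flow (show ((0 : ℝ≥0) : ℝ) < z 0 from (z 0).2)]; simp

lemma mem_switchCountSet_seqCons {x : Ioi (0 : ℝ)} {r : ℝ≥0}
    (hr : (r : ℝ) = t - x) :
    seqCons x z ∈ switchCountSet (n + 1) t ↔ z ∈ switchCountSet n r := by
  simp only [switchCountSet, mem_ofPred_eq, switchTime_seqCons, hr, le_sub_iff_add_le',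
    sub_lt_iff_lt_add']

lemma path_seqCons {x : Ioi (0 : ℝ)} {r : ℝ≥0} (hr : (r : ℝ) = t - x)
    (hn : (r : ℝ) < switchTime z n) : path a e (seqCons x z) t = path a (jump a x e) z r := by
  obtain ⟨k, hk⟩ := exists_mem_switchCountSet hn
  rw [path_eq hk, path_eq ((mem_switchCountSet_seqCons hr).mpr hk), skeleton_seqCons,
    switchTime_seqCons, hr]
  congr 1; ring

lemma path_seqCons_add {x y : Ioi (0 : ℝ)} {s : ℝ≥0} (hxy : (y : ℝ) = x - s) :
    path a e (seqCons x z) (s + t) = path a (flow a s e) (seqCons y z) t := by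
  have hT : ∀ n, switchTime (seqCons x z) (n + 1) = s + switchTime (seqCons y z) (n + 1) :=
    fun n => by rw [switchTime_seqCons, switchTime_seqCons, hxy]; ring
  have hT_le : ∀ n, switchTime (seqCons y z) n ≤ t →
      switchTime (seqCons x z) n ≤ (s + t : ℝ≥0) := fun n hn => by
    cases n with
    | zero => simpa using add_nonneg s.2 t.2
    | succ n => rw [hT, NNReal.coe_add]; gcongr
  rcases exists_mem_switchCountSet_or_explosion (seqCons y z) t with ⟨k, hk⟩ | hle
  · have hk' : seqCons x z ∈ switchCountSet k (s + t) := by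
      refine ⟨hT_le k hk.1, ?_⟩
      rw [hT, NNReal.coe_add]
      gcongr
      exact hk.2
    rw [path_eq hk, path_eq hk']
    cases k with
    | zero =>
      simp only [skeleton, switchTime_zero, flow_flow, sub_zero, NNReal.coe_add]
    | succ k =>
      rw [skeleton_seqCons, skeleton_seqCons, jump_flow, hT, hxy, add_sub_cancel, NNReal.coe_add,
        add_sub_add_left_eq_sub]
  · rw [path_eq_of_explosion hle, path_eq_of_explosion fun n => hT_le n (hle n), flow_flow,
      NNReal.coe_add]

lemma path_rightContinuous (a : ℝ) (e : E) (z : ℕ → Ioi (0 : ℝ)) (t : ℝ≥0) :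
    ContinuousWithinAt (fun s => path a e z s) (Ici t) t := by
  have hflow : ∀ (c : ℝ) (x : E), Continuous fun s : ℝ≥0 => flow a (s - c) x := fun c x =>
    (continuous_flow_left a x).comp (by fun_prop)
  rcases exists_mem_switchCountSet_or_explosion z t with ⟨k, hk⟩ | hle
  · refine (hflow (switchTime z k) (skeleton a e z k)).continuousWithinAt.congr_of_eventuallyEq
      ?_ (path_eq hk)
    have hlt : ∀ᶠ s : ℝ≥0 in 𝓝[≥] t, (s : ℝ) < switchTime z (k + 1) :=
      nhdsWithin_le_nhds ((NNReal.continuous_coe.tendsto t).eventually (gt_mem_nhds hk.2))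
    filter_upwards [hlt, self_mem_nhdsWithin] with s hs hts
    exact path_eq ⟨hk.1.trans (NNReal.coe_le_coe.mpr hts), hs⟩
  · have hpath : ∀ s ∈ Ici t, path a e z s = flow a (s - 0) e := fun s hs => by
      rw [path_eq_of_explosion fun n => (hle n).trans (NNReal.coe_le_coe.mpr hs), sub_zero]
    exact (hflow 0 e).continuousWithinAt.congr hpath (hpath t self_mem_Ici)

lemma abs_flow_sub (a s : ℝ) (e : E) : |(flow a s e).1 - e.1| = |a| * |s| := by
  rw [flow, add_sub_cancel_left, abs_mul, abs_mul, abs_sgn, mul_one]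

lemma abs_skeleton_sub_le (a : ℝ) (e : E) (z : ℕ → Ioi (0 : ℝ)) (n : ℕ) :
    |(skeleton a e z n).1 - e.1| ≤ |a| * switchTime z n := by
  induction n with
  | zero => simp [skeleton]
  | succ n ih =>
    calc |(skeleton a e z (n + 1)).1 - e.1|
        ≤ |(flow a (z n) (skeleton a e z n)).1 - (skeleton a e z n).1|
          + |(skeleton a e z n).1 - e.1| := abs_sub_le _ _ _
      _ ≤ |a| * z n + |a| * switchTime z n := by
          rw [abs_flow_sub, abs_of_pos (show (0 : ℝ) < z n from (z n).2)]; gcongr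
      _ = |a| * switchTime z (n + 1) := by rw [switchTime_succ]; ring

lemma abs_path_sub_le (a : ℝ) (e : E) (z : ℕ → Ioi (0 : ℝ)) (t : ℝ≥0) :
    |(path a e z t).1 - e.1| ≤ |a| * t := by
  set n := switchCount z t
  have hn : 0 ≤ (t : ℝ) - switchTime z n := sub_nonneg.mpr (switchTime_switchCount_le z t)
  calc |(path a e z t).1 - e.1|
      ≤ |(flow a (t - switchTime z n) (skeleton a e z n)).1 - (skeleton a e z n).1|
        + |(skeleton a e z n).1 - e.1| := abs_sub_le _ _ _
    _ ≤ |a| * (t - switchTime z n) + |a| * switchTime z n := by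
        rw [abs_flow_sub, abs_of_nonneg hn]
        gcongr
        exact abs_skeleton_sub_le a e z n
    _ = |a| * t := by ring

end Path

/-! ### Non-explosion -/

section NonExplosion

variable {a : ℝ} {lam : E → ℝ}

lemma exists_rate_le (hlam : Continuous lam) (R : ℝ) :
    ∃ M, 0 ≤ M ∧ ∀ x : E, |x.1| ≤ R → lam x ≤ M := by
  obtain ⟨M, hM⟩ := ((isCompact_Icc (a := -R) (b := R)).prod
    (isCompact_univ (X := ℤˣ))).bddAbove_image hlam.continuousOn
  exact ⟨max M 0, le_max_right _ _, fun x hx =>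
    le_max_of_le_left (hM ⟨x, ⟨abs_le.mp hx, mem_univ _⟩, rfl⟩)⟩

lemma abs_flow_add_le {R s t : ℝ} {e : E} (he : |e.1| + |a| * t ≤ R) (hs : 0 ≤ s) :
    |(flow a s e).1| + |a| * (t - s) ≤ R := by
  have hflow := abs_flow_sub a s e
  rw [abs_of_nonneg hs] at hflow
  linarith [abs_sub_abs_le_abs_sub (flow a s e).1 e.1]

lemma lintegral_mul_pow_div_factorial {M t : ℝ} (hM : 0 ≤ M) (ht : 0 ≤ t) (n : ℕ) :
    ∫⁻ s in Ioc 0 t, ENNReal.ofReal (M * ((M * (t - s)) ^ n / n.factorial))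
      = ENNReal.ofReal ((M * t) ^ (n + 1) / (n + 1).factorial) := by
  have hder : ∀ s ∈ uIcc 0 t, HasDerivAt
      (fun s : ℝ => -((M * (t - s)) ^ (n + 1) / (n + 1).factorial))
      (M * ((M * (t - s)) ^ n / n.factorial)) s := fun s _ => by
    have hd : HasDerivAt (fun s : ℝ => M * (t - s)) (-M) s := by
      simpa using ((hasDerivAt_id s).const_sub t).const_mul M
    refine ((hd.pow (n + 1)).div_const _).neg.congr_deriv ?_
    rw [Nat.factorial_succ]
    push_cast
    field_simp
  have hint : IntervalIntegrable (fun s : ℝ => M * ((M * (t - s)) ^ n / n.factorial)) volume 0 t :=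
    Continuous.intervalIntegrable (by fun_prop) 0 t
  have hnonneg : ∀ s ∈ Ioc 0 t, 0 ≤ M * ((M * (t - s)) ^ n / n.factorial) := fun s hs => by
    have := sub_nonneg.mpr hs.2
    positivity
  rw [← ofReal_integral_eq_lintegral_ofReal hint.1
      ((ae_restrict_iff' measurableSet_Ioc).mpr (.of_forall hnonneg)),
    ← intervalIntegral.integral_of_le ht, intervalIntegral.integral_eq_sub_of_hasDerivAt hder hint]
  simp

namespace IsAdmissible

variable (h : IsAdmissible a lam)
include h

lemma setLIntegral_waitKernel_Iic_le {M t : ℝ} {e : E}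
    (hM : ∀ s ∈ Ioc 0 t, lam (flow a s e) ≤ M) {H : ℝ → ENNReal} (hH : Measurable H) :
    ∫⁻ z in {z : Ioi (0 : ℝ) | z ≤ t}, H z ∂(waitKernel a lam e)
      ≤ ∫⁻ s in Ioc 0 t, ENNReal.ofReal M * H s := by
  have hm : MeasurableSet {z : Ioi (0 : ℝ) | (z : ℝ) ≤ t} :=
    measurable_subtype_coe measurableSet_Iic
  calc ∫⁻ z in {z : Ioi (0 : ℝ) | z ≤ t}, H z ∂(waitKernel a lam e)
      = ∫⁻ z, (Iic t).indicator H z ∂(waitKernel a lam e) := (lintegral_indicator hm _).symm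
    _ = ∫⁻ s in Ioi (0 : ℝ),
          (Iic t).indicator (fun s => ENNReal.ofReal (waitDensity a lam e s) * H s) s := by
        rw [lintegral_waitKernel h.continuous e (hH.indicator measurableSet_Iic)]
        simp only [indicator_apply, mul_ite, mul_zero]
    _ = ∫⁻ s in Ioc 0 t, ENNReal.ofReal (waitDensity a lam e s) * H s := by
        rw [setLIntegral_indicator measurableSet_Iic, inter_comm, Ioi_inter_Iic]
    _ ≤ _ := setLIntegral_mono' measurableSet_Ioc fun s hs => by
        gcongr
        exact (mul_le_of_le_one_right (h.nonneg _)
          (survival_le_one h.nonneg hs.1.le e)).trans (hM s hs)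

lemma seqKernel_switchTime_succ_le (n : ℕ) (t : ℝ) (e : E) :
    h.seqKernel e {z | switchTime z (n + 1) ≤ t}
      = ∫⁻ x in {x : Ioi (0 : ℝ) | x ≤ t}, h.seqKernel (jump a x e) {z | switchTime z n ≤ t - x}
          ∂(waitKernel a lam e) := by
  have hm : MeasurableSet {z | switchTime z (n + 1) ≤ t} :=
    measurableSet_le (measurable_switchTime _) measurable_const
  have hmt : MeasurableSet {x : Ioi (0 : ℝ) | (x : ℝ) ≤ t} :=
    measurable_subtype_coe measurableSet_Iic
  rw [← setLIntegral_one, h.setLIntegral_seqKernel e hm measurable_const,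
    ← lintegral_indicator hmt]
  refine lintegral_congr fun x => ?_
  simp only [setLIntegral_one, indicator_apply, mem_ofPred_eq, switchTime_seqCons,
    le_sub_iff_add_le']
  split_ifs with hx
  · rfl
  · rw [← nonpos_iff_eq_zero, ← measure_empty (μ := h.seqKernel (jump a x e))]
    refine measure_mono fun z hz => hx ?_
    exact (le_add_of_nonneg_right switchTime_nonneg).trans hz

/-- Up to time `t` the path stays in the region `|y| ≤ R`, where the rate is at most `M`; hence the
number of switches is dominated by that of a Poisson process of rate `M`. -/
lemma seqKernel_switchTime_le {M R : ℝ} (hM0 : 0 ≤ M) (hM : ∀ x : E, |x.1| ≤ R → lam x ≤ M)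
    (n : ℕ) {t : ℝ} {e : E} (ht : 0 ≤ t) (he : |e.1| + |a| * t ≤ R) :
    h.seqKernel e {z | switchTime z n ≤ t} ≤ ENNReal.ofReal ((M * t) ^ n / n.factorial) := by
  induction n generalizing t e with
  | zero => simpa using prob_le_one
  | succ n ih =>
    have hrate : ∀ s ∈ Ioc 0 t, lam (flow a s e) ≤ M := fun s hs => hM _ <|
      (le_add_of_nonneg_right (mul_nonneg (abs_nonneg a) (sub_nonneg.mpr hs.2))).trans
        (abs_flow_add_le he hs.1.le)
    rw [h.seqKernel_switchTime_succ_le]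
    calc _ ≤ ∫⁻ x in {x : Ioi (0 : ℝ) | x ≤ t}, ENNReal.ofReal ((M * (t - x)) ^ n / n.factorial)
            ∂(waitKernel a lam e) :=
          setLIntegral_mono' (measurable_subtype_coe measurableSet_Iic) fun x hx =>
            ih (e := jump a x e) (sub_nonneg.mpr hx) (abs_flow_add_le he (le_of_lt x.2))
      _ ≤ ∫⁻ s in Ioc 0 t, ENNReal.ofReal M * ENNReal.ofReal ((M * (t - s)) ^ n / n.factorial) :=
          h.setLIntegral_waitKernel_Iic_le hrate
            (H := fun s => ENNReal.ofReal ((M * (t - s)) ^ n / n.factorial)) (by fun_prop)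
      _ = _ := by simp only [← ENNReal.ofReal_mul hM0, lintegral_mul_pow_div_factorial hM0 ht]

lemma ae_exists_lt_switchTime (e : E) {t : ℝ} (ht : 0 ≤ t) :
    ∀ᵐ z ∂(h.seqKernel e), ∃ n, t < switchTime z n := by
  obtain ⟨M, hM0, hM⟩ := exists_rate_le h.continuous (|e.1| + |a| * t)
  have hlim : Tendsto (fun n : ℕ => ENNReal.ofReal ((M * t) ^ n / n.factorial)) atTop (𝓝 0) := by
    simpa using ENNReal.tendsto_ofReal (FloorSemiring.tendsto_pow_div_factorial_atTop (M * t))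
  rw [ae_iff, ← nonpos_iff_eq_zero]
  refine ge_of_tendsto' hlim fun n =>
    (measure_mono fun z hz => ?_).trans (h.seqKernel_switchTime_le hM0 hM n ht le_rfl)
  simp only [not_exists, not_lt, mem_ofPred_eq] at hz ⊢
  exact hz n

lemma ae_tendsto_switchTime (e : E) :
    ∀ᵐ z ∂(h.seqKernel e), Tendsto (switchTime z) atTop atTop := by
  have hN : ∀ N : ℕ, ∀ᵐ z ∂(h.seqKernel e), ∃ n, (N : ℝ) < switchTime z n := fun N =>
    h.ae_exists_lt_switchTime e N.cast_nonneg
  filter_upwards [ae_all_iff.mpr hN] with z hz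
  refine tendsto_atTop_atTop_of_monotone strictMono_switchTime.monotone fun b => ?_
  obtain ⟨N, hbN⟩ := exists_nat_ge b
  obtain ⟨n, hn⟩ := hz N
  exact ⟨n, hbN.trans hn.le⟩

end IsAdmissible

end NonExplosion

/-! ### The transition semigroup and the Markov property -/

lemma measurable_path_prod (a : ℝ) (t : ℝ≥0) :
    Measurable fun p : E × (ℕ → Ioi (0 : ℝ)) => path a p.1 p.2 t := by
  have hskeleton : ∀ n, Measurable fun p : E × (ℕ → Ioi (0 : ℝ)) => skeleton a p.1 p.2 n :=
    fun n => by
      induction n with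
      | zero => exact measurable_fst
      | succ n ih => exact (continuous_jump a).measurable.comp ((measurable_subtype_coe.comp
          ((measurable_pi_apply n).comp measurable_snd)).prodMk ih)
  have hflow : Measurable fun q : (E × (ℕ → Ioi (0 : ℝ))) × ℕ =>
      flow a (t - switchTime q.1.2 q.2) (skeleton a q.1.1 q.1.2 q.2) :=
    measurable_from_prod_countable_left fun n => (continuous_flow a).measurable.comp
      ((((measurable_switchTime n).comp measurable_snd).const_sub _).prodMk (hskeleton n))
  exact hflow.comp (measurable_id.prodMk ((measurable_switchCount t).comp measurable_snd))

/-- A set of sequences of waiting times is determined at time `s` if membership depends only on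
the number of switches up to time `s` and on the waiting times before them. -/
def IsDetermined (s : ℝ≥0) (A : Set (ℕ → Ioi (0 : ℝ))) : Prop :=
  ∀ n z z', (∀ i < n, z i = z' i) → z ∈ switchCountSet n s → z' ∈ switchCountSet n s →
    z ∈ A → z' ∈ A

namespace IsDetermined

lemma univ (s : ℝ≥0) : IsDetermined s Set.univ := fun _ _ _ _ _ _ _ => mem_univ _

lemma compl {s : ℝ≥0} {A : Set (ℕ → Ioi (0 : ℝ))} (hA : IsDetermined s A) :
    IsDetermined s Aᶜ := fun n z z' hz h h' hzA hz'A =>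
  hzA (hA n z' z (fun i hi => (hz i hi).symm) h' h hz'A)

lemma iUnion {s : ℝ≥0} {A : ℕ → Set (ℕ → Ioi (0 : ℝ))} (hA : ∀ k, IsDetermined s (A k)) :
    IsDetermined s (⋃ k, A k) := fun n z z' hz h h' hzA => by
  obtain ⟨k, hk⟩ := mem_iUnion.mp hzA
  exact mem_iUnion.mpr ⟨k, hA k n z z' hz h h' hk⟩

lemma setOf_path_mem (a : ℝ) (e : E) {r s : ℝ≥0} (hrs : r ≤ s) (B : Set E) :
    IsDetermined s {z | path a e z r ∈ B} := by
  intro n z z' hz h h' hzB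
  have hrs' : (r : ℝ) ≤ s := hrs
  obtain ⟨k, hk⟩ := exists_mem_switchCountSet (hrs'.trans_lt h.2)
  have hkn : k ≤ n := by
    have := strictMono_switchTime.lt_iff_lt.mp ((hk.1.trans hrs').trans_lt h.2)
    lia
  have hzk : ∀ i < k, z i = z' i := fun i hi => hz i (by lia)
  have hk' : z' ∈ switchCountSet k r := by
    refine ⟨switchTime_congr hzk ▸ hk.1, ?_⟩
    rcases hkn.lt_or_eq with hlt | rfl
    · rw [← switchTime_congr (n := k + 1) fun i hi => hz i (by lia)]
      exact hk.2
    · exact hrs'.trans_lt h'.2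
  simp only [mem_ofPred_eq, path_eq hk, path_eq hk'] at hzB ⊢
  rwa [← switchTime_congr hzk, ← skeleton_congr hzk]

lemma setOf_seqCons_mem {s r : ℝ≥0} {A : Set (ℕ → Ioi (0 : ℝ))} (hA : IsDetermined s A)
    {x : Ioi (0 : ℝ)} (hr : (r : ℝ) = s - x) :
    IsDetermined r {z | seqCons x z ∈ A} := by
  intro n z z' hz h h' hzA
  refine hA (n + 1) _ _ (fun i hi => ?_) ((mem_switchCountSet_seqCons hr).mpr h)
    ((mem_switchCountSet_seqCons hr).mpr h') hzA
  cases i with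
  | zero => rfl
  | succ i => exact hz i (by lia)

end IsDetermined

namespace IsAdmissible

variable {a : ℝ} {lam : E → ℝ} (h : IsAdmissible a lam)

/-- The transition semigroup of the zig-zag process. -/
noncomputable def semigroup (t : ℝ≥0) : Kernel E E :=
  (Kernel.id ×ₖ h.seqKernel).map fun p => path a p.1 p.2 t

instance (t : ℝ≥0) : IsMarkovKernel (h.semigroup t) :=
  Kernel.IsMarkovKernel.map _ (measurable_path_prod a t)

lemma semigroup_apply (t : ℝ≥0) (e : E) :
    h.semigroup t e = (h.seqKernel e).map fun z => path a e z t := by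
  rw [semigroup, Kernel.map_apply _ (measurable_path_prod a t), Kernel.prod_apply,
    Kernel.id_apply, Measure.dirac_prod,
    Measure.map_map (measurable_path_prod a t) measurable_prodMk_left]
  rfl

lemma lintegral_semigroup (t : ℝ≥0) (e : E) {f : E → ENNReal} (hf : Measurable f) :
    ∫⁻ y, f y ∂(h.semigroup t e) = ∫⁻ z, f (path a e z t) ∂(h.seqKernel e) := by
  rw [semigroup_apply, lintegral_map hf (measurable_path a e t)]

lemma setLIntegral_path_add_of_lt_first (s t : ℝ≥0) (e : E) {f : E → ENNReal} (hf : Measurable f) :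
    ∫⁻ z in {z | (s : ℝ) < z 0}, f (path a e z (s + t)) ∂(h.seqKernel e)
      = ENNReal.ofReal (survival a lam s e) * ∫⁻ y, f y ∂(h.semigroup t (flow a s e)) := by
  have hset : MeasurableSet {z : ℕ → Ioi (0 : ℝ) | (s : ℝ) < z 0} :=
    measurableSet_lt measurable_const (measurable_subtype_coe.comp (measurable_pi_apply 0))
  have hm : ∀ e t, Measurable fun z => f (path a e z t) := fun e t =>
    hf.comp (measurable_path a e t)
  let e' := flow a s e
  obtain ⟨H, hH, hHext⟩ :=
    (MeasurableEmbedding.subtype_coe measurableSet_Ioi).exists_measurable_extend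
      (h.measurable_lintegral_seqCons e' (hm e' t)) fun _ => ⟨0⟩
  have hH_coe : ∀ y : Ioi (0 : ℝ), H y
      = ∫⁻ z, f (path a e' (seqCons y z) t) ∂(h.seqKernel (jump a y e')) := congrFun hHext
  have hset_Ioi : MeasurableSet {x : Ioi (0 : ℝ) | (s : ℝ) < x} :=
    measurable_subtype_coe measurableSet_Ioi
  calc ∫⁻ z in {z | (s : ℝ) < z 0}, f (path a e z (s + t)) ∂(h.seqKernel e)
      = ∫⁻ x in {x : Ioi (0 : ℝ) | (s : ℝ) < x}, H (x - s) ∂(waitKernel a lam e) := by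
        rw [h.setLIntegral_seqKernel e hset (hm e _), ← lintegral_indicator hset_Ioi]
        refine lintegral_congr fun x => ?_
        by_cases hx : (s : ℝ) < x
        · have hH_sub := hH_coe ⟨x - s, sub_pos.mpr hx⟩
          simp only [e', jump_flow, add_sub_cancel] at hH_sub
          simp only [indicator, mem_ofPred_eq, seqCons_zero, hx, if_true, hH_sub, ofPred_true,
            Measure.restrict_univ]
          exact lintegral_congr fun z => by rw [path_seqCons_add (y := ⟨x - s, sub_pos.mpr hx⟩) rfl]
        · simp [indicator, hx]
    _ = ENNReal.ofReal (survival a lam s e) * ∫⁻ y, H y ∂(waitKernel a lam e') :=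
        setLIntegral_waitKernel_Ioi_sub h.continuous s.coe_nonneg e hH
    _ = _ := by
        rw [h.lintegral_semigroup t _ hf, h.lintegral_seqKernel _ (hm e' t)]
        simp only [hH_coe, e']

lemma setLIntegral_path_add_inter_switchCountSet_zero {s : ℝ≥0} (t : ℝ≥0) (e : E)
    {A : Set (ℕ → Ioi (0 : ℝ))} (hA : IsDetermined s A) {f : E → ENNReal} (hf : Measurable f) :
    ∫⁻ z in A ∩ switchCountSet 0 s, f (path a e z (s + t)) ∂(h.seqKernel e)
      = ∫⁻ z in A ∩ switchCountSet 0 s, ∫⁻ y, f y ∂(h.semigroup t (path a e z s))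
          ∂(h.seqKernel e) := by
  have hset : switchCountSet 0 s = {z : ℕ → Ioi (0 : ℝ) | (s : ℝ) < z 0} := by
    ext z; simp [switchCountSet, switchTime_succ]
  rcases (A ∩ switchCountSet 0 s).eq_empty_or_nonempty with hempty | ⟨z₀, hz₀A, hz₀⟩
  · simp [hempty]
  have hinter : A ∩ switchCountSet 0 s = {z : ℕ → Ioi (0 : ℝ) | (s : ℝ) < z 0} := by
    rw [← hset, inter_eq_right]
    exact fun z hz => hA 0 z₀ z (by simp) hz₀ hz hz₀A
  have hzero := h.setLIntegral_path_add_of_lt_first s 0 e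
    (f := fun y => ∫⁻ y', f y' ∂(h.semigroup t y)) hf.lintegral_kernel
  rw [h.lintegral_semigroup 0 _ hf.lintegral_kernel] at hzero
  rw [hinter, h.setLIntegral_path_add_of_lt_first s t e hf]
  simpa using hzero.symm

/-- The Markov property at time `s` on the event of `n` switches up to time `s`. The induction
conditions on the first switch. -/
lemma setLIntegral_path_add_inter_switchCountSet (n : ℕ) {s : ℝ≥0} (t : ℝ≥0) (e : E)
    {A : Set (ℕ → Ioi (0 : ℝ))} (hA : MeasurableSet A) (hAs : IsDetermined s A)
    {f : E → ENNReal} (hf : Measurable f) :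
    ∫⁻ z in A ∩ switchCountSet n s, f (path a e z (s + t)) ∂(h.seqKernel e)
      = ∫⁻ z in A ∩ switchCountSet n s, ∫⁻ y, f y ∂(h.semigroup t (path a e z s))
          ∂(h.seqKernel e) := by
  induction n generalizing s e A with
  | zero => exact h.setLIntegral_path_add_inter_switchCountSet_zero t e hAs hf
  | succ n ih =>
    have hset : MeasurableSet (A ∩ switchCountSet (n + 1) s) :=
      hA.inter (measurableSet_switchCountSet _ _)
    have hm : ∀ {g : E → ENNReal} (r : ℝ≥0), Measurable g →
        Measurable fun z => g (path a e z r) := fun r hg => hg.comp (measurable_path a e r)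
    rw [h.setLIntegral_seqKernel e hset (hm _ hf),
      h.setLIntegral_seqKernel e hset (hm _ hf.lintegral_kernel)]
    refine lintegral_congr fun x => ?_
    rcases le_or_gt (x : ℝ) s with hx | hx
    · let r : ℝ≥0 := ⟨s - x, sub_nonneg.mpr hx⟩
      have hr : (r : ℝ) = s - x := rfl
      have hrt : ((r + t : ℝ≥0) : ℝ) = ((s + t : ℝ≥0) : ℝ) - x := by
        push_cast; rw [hr]; ring
      let A' := {z | seqCons x z ∈ A}
      have hA' : MeasurableSet A' := measurable_seqCons.comp measurable_prodMk_left hA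
      have hpre : {z | seqCons x z ∈ A ∩ switchCountSet (n + 1) s} = A' ∩ switchCountSet n r := by
        ext z; exact and_congr Iff.rfl (mem_switchCountSet_seqCons hr)
      have hset' := hA'.inter (measurableSet_switchCountSet n r)
      rw [hpre]
      refine Eq.trans (lintegral_congr_ae (ae_restrict_of_ae ?_))
        ((ih _ hA' (hAs.setOf_seqCons_mem hr)).trans
          (setLIntegral_congr_fun hset' fun z hz => by rw [path_seqCons hr hz.2.2]))
      filter_upwards [h.ae_exists_lt_switchTime (jump a x e) (r + t).coe_nonneg] with z ⟨m, hm⟩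
      rw [path_seqCons hrt hm]
    · have hpre : {z | seqCons x z ∈ A ∩ switchCountSet (n + 1) s} = ∅ :=
        eq_empty_of_forall_notMem fun z hz => by
          have := hz.2.1
          rw [switchTime_seqCons] at this
          linarith [switchTime_nonneg (z := z) (n := n)]
      rw [hpre, Measure.restrict_empty, lintegral_zero_measure, lintegral_zero_measure]

lemma setLIntegral_path_add {s : ℝ≥0} (t : ℝ≥0) (e : E) {A : Set (ℕ → Ioi (0 : ℝ))}
    (hA : MeasurableSet A) (hAs : IsDetermined s A) {f : E → ENNReal} (hf : Measurable f) :
    ∫⁻ z in A, f (path a e z (s + t)) ∂(h.seqKernel e)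
      = ∫⁻ z in A, ∫⁻ y, f y ∂(h.semigroup t (path a e z s)) ∂(h.seqKernel e) := by
  have hae : A =ᵐ[h.seqKernel e] ⋃ n, A ∩ switchCountSet n s := by
    filter_upwards [h.ae_exists_lt_switchTime e s.coe_nonneg] with z ⟨n, hn⟩
    rw [← inter_iUnion]
    exact propext (and_iff_left (mem_iUnion.mpr (exists_mem_switchCountSet hn))).symm
  have hm : ∀ n, MeasurableSet (A ∩ switchCountSet n s) := fun n =>
    hA.inter (measurableSet_switchCountSet _ _)
  have hd : Pairwise (Function.onFun Disjoint fun n => A ∩ switchCountSet n s) := fun k l hkl =>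
    (disjoint_switchCountSet s hkl).mono inter_subset_right inter_subset_right
  rw [setLIntegral_congr hae, setLIntegral_congr hae, lintegral_iUnion hm hd,
    lintegral_iUnion hm hd]
  exact tsum_congr fun n => h.setLIntegral_path_add_inter_switchCountSet n t e hA hAs hf

theorem isMarkovSemigroup : IsMarkovSemigroup h.semigroup where
  isMarkovKernel t := inferInstance
  zero := by
    ext1 e
    rw [semigroup_apply, Kernel.id_apply]
    simp
  add s t := by
    ext1 e
    refine Measure.ext_of_lintegral _ fun f hf => ?_
    rw [Kernel.lintegral_comp _ _ _ hf, h.lintegral_semigroup _ _ hf,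
      h.lintegral_semigroup _ _ hf.lintegral_kernel]
    simpa only [Measure.restrict_univ] using
      h.setLIntegral_path_add t e MeasurableSet.univ (IsDetermined.univ s) hf

end IsAdmissible

/-! ### Existence and uniqueness in law of the waiting times -/

lemma condProb_comap_ae_eq_iff {Ω β : Type*} [MeasurableSpace Ω] [MeasurableSpace β]
    {μ : Measure Ω} [IsFiniteMeasure μ] {f : Ω → β} (hf : Measurable f) {S : Set Ω}
    (hS : MeasurableSet S) {g : β → ℝ} (hg : Measurable g) (hg₀ : ∀ b, 0 ≤ g b)
    (hg₁ : ∀ b, g b ≤ 1) :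
    (μ⟦S | MeasurableSpace.comap f inferInstance⟧ =ᵐ[μ] fun ω => g (f ω)) ↔
      ∀ B, MeasurableSet B →
        μ (f ⁻¹' B ∩ S) = ∫⁻ ω in f ⁻¹' B, ENNReal.ofReal (g (f ω)) ∂μ := by
  have hgi : Integrable (fun ω => g (f ω)) μ := Integrable.of_bound
    (hg.comp hf).aestronglyMeasurable 1
    (.of_forall fun ω => by rw [Real.norm_eq_abs, abs_of_nonneg (hg₀ _)]; exact hg₁ _)
  have hSi : Integrable (S.indicator fun _ => (1 : ℝ)) μ := (integrable_const 1).indicator hS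
  have hSint : ∀ A, ∫ ω in A, S.indicator (fun _ => (1 : ℝ)) ω ∂μ = μ.real (A ∩ S) := fun A => by
    rw [setIntegral_indicator hS, setIntegral_const, smul_eq_mul, mul_one]
  have hgint : ∀ A, ENNReal.ofReal (∫ ω in A, g (f ω) ∂μ)
      = ∫⁻ ω in A, ENNReal.ofReal (g (f ω)) ∂μ := fun A =>
    ofReal_integral_eq_lintegral_ofReal hgi.integrableOn (.of_forall fun _ => hg₀ _)
  constructor
  · intro h B hB
    rw [← hgint, ← setIntegral_congr_ae (hf hB) (h.mono fun ω hω _ => hω),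
      setIntegral_condExp hf.comap_le hSi ⟨B, hB, rfl⟩, hSint, ofReal_measureReal]
  · intro h
    refine (ae_eq_condExp_of_forall_setIntegral_eq hf.comap_le hSi
      (fun _ _ _ => hgi.integrableOn) ?_
      (hg.comp (comap_measurable f)).stronglyMeasurable.aestronglyMeasurable).symm
    rintro _ ⟨B, hB, rfl⟩ -
    rw [hSint, measureReal_def, h B hB, ← hgint,
      ENNReal.toReal_ofReal (integral_nonneg fun _ => hg₀ _)]

lemma measure_ext_of_prod_Ioi {X T : Type*} [MeasurableSpace X] [TopologicalSpace T]
    [SecondCountableTopology T] [LinearOrder T] [OrderTopology T] [MeasurableSpace T]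
    [BorelSpace T] {μ ν : Measure (X × T)} [IsFiniteMeasure μ] [IsFiniteMeasure ν]
    (huniv : ∀ B, MeasurableSet B → μ (B ×ˢ univ) = ν (B ×ˢ univ))
    (hIoi : ∀ B, MeasurableSet B → ∀ t, μ (B ×ˢ Ioi t) = ν (B ×ˢ Ioi t)) : μ = ν := by
  refine Measure.ext_prod fun {B C} hB hC => ?_
  have happly : ∀ (ρ : Measure (X × T)) {D : Set T}, MeasurableSet D →
      (ρ.restrict (Prod.fst ⁻¹' B)).map Prod.snd D = ρ (B ×ˢ D) := fun ρ D hD => by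
    rw [Measure.map_apply measurable_snd hD, Measure.restrict_apply (measurable_snd hD),
      Set.prod_eq, inter_comm]
  have hsnd : (μ.restrict (Prod.fst ⁻¹' B)).map Prod.snd
      = (ν.restrict (Prod.fst ⁻¹' B)).map Prod.snd := by
    refine Measure.ext_of_Iic _ _ fun t => ?_
    rw [← compl_Ioi, measure_compl measurableSet_Ioi (measure_ne_top _ _),
      measure_compl measurableSet_Ioi (measure_ne_top _ _)]
    simp only [happly _ MeasurableSet.univ, happly _ measurableSet_Ioi, huniv B hB, hIoi B hB]
  rw [← happly μ hC, hsnd, happly ν hC]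

section Take

variable {X : Type*} [MeasurableSpace X]

lemma measurable_take (n : ℕ) : Measurable fun (z : ℕ → X) (k : Fin n) => z k :=
  measurable_pi_lambda _ fun _ => measurable_pi_apply _

omit [MeasurableSpace X] in
lemma take_succ_eq_snoc_comp {Ω : Type*} (Z : ℕ → Ω → X) (n : ℕ) :
    (fun ω (k : Fin (n + 1)) => Z k ω)
      = (fun q : (Fin n → X) × X => Fin.snoc (α := fun _ => X) q.1 q.2)
        ∘ fun ω => ((fun k : Fin n => Z k ω), Z n ω) := by
  funext ω k
  refine Fin.lastCases ?_ (fun k => ?_) k <;> simp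

lemma measurable_finSnoc (n : ℕ) :
    Measurable fun q : (Fin n → X) × X => Fin.snoc (α := fun _ => X) q.1 q.2 := by
  refine measurable_pi_lambda _ fun k => ?_
  refine Fin.lastCases ?_ (fun k => ?_) k
  · simpa using measurable_snd
  · simpa [Function.comp_def] using (measurable_pi_apply k).comp measurable_fst

lemma measure_ext_of_map_take {μ ν : Measure (ℕ → X)} [IsFiniteMeasure ν]
    (h : ∀ n, μ.map (fun (z : ℕ → X) (k : Fin n) => z k)
      = ν.map fun (z : ℕ → X) (k : Fin n) => z k) : μ = ν := by
  have hproj : IsProjectiveLimit μ fun I : Finset ℕ => ν.map I.restrict := fun I => by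
    obtain ⟨n, hn⟩ := I.exists_nat_subset_range
    have hlt : ∀ i : I, (i : ℕ) < n := fun i => Finset.mem_range.mp (hn i.2)
    have hrestrict : Measurable fun (p : Fin n → X) (i : I) => p ⟨i, hlt i⟩ :=
      measurable_pi_lambda _ fun i => measurable_pi_apply _
    have hcomp : I.restrict (π := fun _ : ℕ => X)
        = (fun (p : Fin n → X) (i : I) => p ⟨i, hlt i⟩) ∘ fun z k => z k := rfl
    simp only [hcomp, ← Measure.map_map hrestrict (measurable_take n), h]
  exact hproj.unique fun I => rfl

end Take

/-- The sequence with given first `n` terms and, as an arbitrary choice, all other terms `1`. It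
makes the state after `n` switches a function of the first `n` waiting times. -/
noncomputable def extendSeq {n : ℕ} (p : Fin n → Ioi (0 : ℝ)) (k : ℕ) : Ioi (0 : ℝ) :=
  if hk : k < n then p ⟨k, hk⟩ else ⟨1, mem_Ioi.mpr one_pos⟩

lemma measurable_extendSeq (n : ℕ) : Measurable (extendSeq (n := n)) := by
  refine measurable_pi_lambda _ fun k => ?_
  unfold extendSeq
  split_ifs with hk
  · exact measurable_pi_apply _
  · exact measurable_const

lemma skeleton_extendSeq {Ω : Type*} (a : ℝ) (e : E) (Z : ℕ → Ω → Ioi (0 : ℝ)) (n : ℕ) (ω : Ω) :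
    skeleton a e (extendSeq fun k : Fin n => Z k ω) n = skeleton a e (fun k => Z k ω) n :=
  skeleton_congr fun i hi => by simp [extendSeq, hi]

lemma measurable_skeleton_extendSeq (a : ℝ) (e : E) (n : ℕ) :
    Measurable fun p : Fin n → Ioi (0 : ℝ) => skeleton a e (extendSeq p) n :=
  (measurable_skeleton a e n).comp (measurable_extendSeq n)

lemma measurableSet_lt_coe (t : ℝ) : MeasurableSet {x : Ioi (0 : ℝ) | t < (x : ℝ)} :=
  measurableSet_lt measurable_const measurable_subtype_coe

variable {a : ℝ} {lam : E → ℝ} {Ω : Type*} [MeasurableSpace Ω] {μ : Measure Ω}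
  {Z : ℕ → Ω → Ioi (0 : ℝ)} {e : E}

lemma measurable_survival (hlam : Continuous lam) (t : ℝ) :
    Measurable fun e => survival a lam t e :=
  (continuous_survival hlam).measurable.comp measurable_prodMk_left

lemma measurable_survival_extendSeq (hlam : Continuous lam) (t : ℝ) (e : E) (n : ℕ) :
    Measurable fun p : Fin n → Ioi (0 : ℝ) => survival a lam t (skeleton a e (extendSeq p) n) :=
  (measurable_survival hlam t).comp (measurable_skeleton_extendSeq a e n)

lemma isWaitingTimes_iff (hlam : Continuous lam) (hlam₀ : ∀ x, 0 ≤ lam x)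
    [hμ : IsProbabilityMeasure μ] (hZ : ∀ n, Measurable (Z n)) :
    IsWaitingTimes a lam e μ Z ↔ ∀ (n : ℕ) (t : ℝ), 0 ≤ t →
      ∀ B : Set (Fin n → Ioi (0 : ℝ)), MeasurableSet B →
        μ ((fun ω (k : Fin n) => Z k ω) ⁻¹' B ∩ {ω | t < (Z n ω : ℝ)})
          = ∫⁻ ω in (fun ω (k : Fin n) => Z k ω) ⁻¹' B,
              ENNReal.ofReal (survival a lam t (skeleton a e (fun k => Z k ω) n)) ∂μ := by
  have hcond := fun n t (ht : (0 : ℝ) ≤ t) => condProb_comap_ae_eq_iff (μ := μ)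
    (measurable_pi_lambda (fun ω (k : Fin n) => Z k ω) fun k => hZ k)
    (hZ n (measurableSet_lt_coe t))
    (measurable_survival_extendSeq (a := a) hlam t e n)
    (fun _ => (survival_pos _ _).le) (fun _ => survival_le_one hlam₀ ht _)
  simp only [MeasurableSpace.comap_process_pi, skeleton_extendSeq a e Z] at hcond
  exact ⟨fun h n t ht => (hcond n t ht).mp (h.condProb n t ht),
    fun h => ⟨hμ, hZ, fun n t ht => (hcond n t ht).mpr (h n t ht)⟩⟩

namespace IsAdmissible

variable (h : IsAdmissible a lam)
include h

lemma seqKernel_inter_lt_apply {t : ℝ} (ht : 0 ≤ t) (n : ℕ) (e : E)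
    {A : Set (ℕ → Ioi (0 : ℝ))} (hA : MeasurableSet A)
    (hAn : ∀ z z', (∀ i < n, z i = z' i) → z ∈ A → z' ∈ A) :
    h.seqKernel e (A ∩ {z | t < (z n : ℝ)})
      = ∫⁻ z in A, ENNReal.ofReal (survival a lam t (skeleton a e z n)) ∂(h.seqKernel e) := by
  have hlt : ∀ n, MeasurableSet {z : ℕ → Ioi (0 : ℝ) | t < (z n : ℝ)} := fun n =>
    measurableSet_lt measurable_const (measurable_subtype_coe.comp (measurable_pi_apply n))
  have hsurvival : ∀ e n, Measurable fun z =>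
      ENNReal.ofReal (survival a lam t (skeleton a e z n)) := fun e n =>
    ((measurable_survival h.continuous t).comp (measurable_skeleton a e n)).ennreal_ofReal
  induction n generalizing e A with
  | zero =>
    rcases A.eq_empty_or_nonempty with rfl | ⟨z₀, hz₀⟩
    · simp
    obtain rfl : A = univ := eq_univ_of_forall fun z => hAn z₀ z (by simp) hz₀
    have hfirst := h.lintegral_seqKernel e (measurable_one.indicator (hlt 0))
    simp only [skeleton, univ_inter, lintegral_const, measure_univ, mul_one, Measure.restrict_univ,
      lintegral_indicator_one (hlt 0), ← h.waitKernel_Ioi ht e] at hfirst ⊢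
    rw [hfirst, ← lintegral_indicator_one (measurableSet_lt_coe t)]
    refine lintegral_congr fun x => ?_
    by_cases hx : t < (x : ℝ) <;> simp [indicator, hx]
  | succ n ih =>
    rw [inter_comm, ← Measure.restrict_apply (hlt (n + 1)), ← lintegral_indicator_one (hlt (n + 1)),
      h.setLIntegral_seqKernel e hA (measurable_one.indicator (hlt (n + 1))),
      h.setLIntegral_seqKernel e hA (hsurvival e (n + 1))]
    refine lintegral_congr fun x => ?_
    have hAx : MeasurableSet {z | seqCons x z ∈ A} :=
      measurable_seqCons.comp measurable_prodMk_left hA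
    have hx := ih (jump a x e) hAx fun z z' hz => hAn _ _ (by
      rintro (_ | i) hi
      · rfl
      · exact hz i (by lia))
    simp only [skeleton_seqCons]
    rw [← hx, inter_comm, ← Measure.restrict_apply (hlt n), ← lintegral_indicator_one (hlt n)]
    rfl

theorem isWaitingTimes_seqKernel (e : E) :
    IsWaitingTimes a lam e (h.seqKernel e) fun n z => z n :=
  (isWaitingTimes_iff h.continuous h.nonneg measurable_pi_apply).mpr fun n _ ht B hB =>
    h.seqKernel_inter_lt_apply ht n e (measurable_take n hB)
      fun z z' hz (hzB : (fun k : Fin n => z k) ∈ B) =>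
        show (fun k : Fin n => z' k) ∈ B from
          (funext fun k => hz k k.2 : (fun k : Fin n => z k) = fun k : Fin n => z' k) ▸ hzB

end IsAdmissible

namespace IsWaitingTimes

variable (hZ : IsWaitingTimes a lam e μ Z) (h : IsAdmissible a lam)
include hZ h

lemma map_take_prodMk (n : ℕ) :
    μ.map (fun ω => ((fun k : Fin n => Z k ω), Z n ω))
      = μ.map (fun ω (k : Fin n) => Z k ω)
        ⊗ₘ (waitKernel a lam).comap _ (measurable_skeleton_extendSeq a e n) := by
  have := hZ.isProbabilityMeasure
  have := h.isMarkovKernel_waitKernel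
  have htake : Measurable fun ω (k : Fin n) => Z k ω :=
    measurable_pi_lambda _ fun k => hZ.measurable k
  have hpair := htake.prodMk (hZ.measurable n)
  have hlt : ∀ B, MeasurableSet B → ∀ t : ℝ, 0 ≤ t →
      μ.map (fun ω => ((fun k : Fin n => Z k ω), Z n ω)) (B ×ˢ {x : Ioi (0 : ℝ) | t < x})
        = (μ.map (fun ω (k : Fin n) => Z k ω)
          ⊗ₘ (waitKernel a lam).comap _ (measurable_skeleton_extendSeq a e n))
          (B ×ˢ {x : Ioi (0 : ℝ) | t < x}) := fun B hB t ht => by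
    rw [Measure.map_apply hpair (hB.prod (measurableSet_lt_coe t)),
      Measure.compProd_apply_prod hB (measurableSet_lt_coe t)]
    simp only [Kernel.comap_apply, h.waitKernel_Ioi ht]
    rw [setLIntegral_map hB (measurable_survival_extendSeq h.continuous t e n).ennreal_ofReal
      htake]
    simp only [skeleton_extendSeq a e Z]
    exact (isWaitingTimes_iff h.continuous h.nonneg hZ.measurable).mp hZ n t ht B hB
  have huniv : {x : Ioi (0 : ℝ) | (0 : ℝ) < x} = univ := eq_univ_of_forall fun x => x.2
  exact measure_ext_of_prod_Ioi (fun B hB => by simpa only [huniv] using hlt B hB 0 le_rfl)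
    fun B hB t => hlt B hB t t.2.le

lemma map_take_eq_of_isWaitingTimes {Ω' : Type*} [MeasurableSpace Ω'] {μ' : Measure Ω'}
    {Z' : ℕ → Ω' → Ioi (0 : ℝ)} (hZ' : IsWaitingTimes a lam e μ' Z') (n : ℕ) :
    μ.map (fun ω (k : Fin n) => Z k ω) = μ'.map fun ω (k : Fin n) => Z' k ω := by
  have := hZ.isProbabilityMeasure
  have := hZ'.isProbabilityMeasure
  have htake : ∀ n, Measurable fun ω (k : Fin n) => Z k ω := fun n =>
    measurable_pi_lambda _ fun k => hZ.measurable k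
  have htake' : ∀ n, Measurable fun ω (k : Fin n) => Z' k ω := fun n =>
    measurable_pi_lambda _ fun k => hZ'.measurable k
  induction n with
  | zero =>
    ext B hB
    rw [Measure.map_apply (htake 0) hB, Measure.map_apply (htake' 0) hB]
    rcases B.eq_empty_or_nonempty with rfl | hB
    · simp
    · simp [Subsingleton.eq_univ_of_nonempty hB]
  | succ n ih =>
    have hpair : μ.map (fun ω => ((fun k : Fin n => Z k ω), Z n ω))
        = μ'.map fun ω => ((fun k : Fin n => Z' k ω), Z' n ω) := by
      rw [hZ.map_take_prodMk h, hZ'.map_take_prodMk h, ih]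
    rw [take_succ_eq_snoc_comp, take_succ_eq_snoc_comp,
      ← Measure.map_map (measurable_finSnoc n) ((htake n).prodMk (hZ.measurable n)),
      ← Measure.map_map (measurable_finSnoc n) ((htake' n).prodMk (hZ'.measurable n)), hpair]

theorem map_eq : (μ.map fun ω k => Z k ω) = h.seqKernel e :=
  measure_ext_of_map_take fun n => by
    rw [Measure.map_map (measurable_take n) (measurable_pi_lambda _ hZ.measurable)]
    exact hZ.map_take_eq_of_isWaitingTimes h (h.isWaitingTimes_seqKernel e) n

lemma map_process (t : ℝ≥0) : μ.map (process a e Z t) = h.semigroup t e := by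
  rw [h.semigroup_apply, ← hZ.map_eq h,
    Measure.map_map (measurable_path a e t) (measurable_pi_lambda _ hZ.measurable)]
  rfl

theorem ae_tendsto_switchTime : ∀ᵐ ω ∂μ, Tendsto (switchTime fun k => Z k ω) atTop atTop :=
  ae_of_ae_map (measurable_pi_lambda _ hZ.measurable).aemeasurable
    (hZ.map_eq h ▸ h.ae_tendsto_switchTime e)

end IsWaitingTimes

/-! ### The Markov property with respect to the natural filtration -/

/-- The σ-algebra of the events that are determined at time `s`. -/
@[reducible] def determinedSpace (s : ℝ≥0) : MeasurableSpace (ℕ → Ioi (0 : ℝ)) where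
  MeasurableSet' A := MeasurableSet A ∧ IsDetermined s A
  measurableSet_empty := ⟨MeasurableSet.empty, fun _ _ _ _ _ _ h => h⟩
  measurableSet_compl _ hA := ⟨hA.1.compl, hA.2.compl⟩
  measurableSet_iUnion _ hA :=
    ⟨MeasurableSet.iUnion fun k => (hA k).1, IsDetermined.iUnion fun k => (hA k).2⟩

lemma filtration_le_comap_determinedSpace (hZ : ∀ n, Measurable (Z n)) (s : ℝ≥0) :
    filtration a e hZ s ≤ (determinedSpace s).comap fun ω k => Z k ω := by
  refine iSup₂_le fun r hr => ?_
  rintro _ ⟨B, hB, rfl⟩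
  exact ⟨{z | path a e z r ∈ B},
    ⟨measurable_path a e r hB, IsDetermined.setOf_path_mem a e hr B⟩, rfl⟩

lemma IsWaitingTimes.map_restrict_process_add (hZ : IsWaitingTimes a lam e μ Z)
    (h : IsAdmissible a lam) (s t : ℝ≥0) {A : Set Ω}
    (hA : MeasurableSet[filtration a e hZ.measurable s] A) :
    (μ.restrict A).map (process a e Z (s + t))
      = h.semigroup t ∘ₘ (μ.restrict A).map (process a e Z s) := by
  obtain ⟨D, ⟨hD, hDs⟩, rfl⟩ := filtration_le_comap_determinedSpace hZ.measurable s A hA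
  have hZm : Measurable fun ω k => Z k ω := measurable_pi_lambda _ hZ.measurable
  have hprocess := measurable_process a e hZ.measurable
  refine Measure.ext_of_lintegral _ fun f hf => ?_
  rw [lintegral_map hf (hprocess _), Measure.lintegral_bind (Kernel.aemeasurable _) hf.aemeasurable,
    lintegral_map hf.lintegral_kernel (hprocess _)]
  have hpath := h.setLIntegral_path_add t e hD hDs hf
  have hpullback : ∀ {g : E → ENNReal} (_ : Measurable g) (r : ℝ≥0),
      ∫⁻ z in D, g (path a e z r) ∂(h.seqKernel e)
        = ∫⁻ ω in (fun ω k => Z k ω) ⁻¹' D, g (process a e Z r ω) ∂μ := fun {g} hg r => by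
    rw [← hZ.map_eq h]
    exact setLIntegral_map hD (hg.comp (measurable_path a e r)) hZm
  rwa [hpullback hf, hpullback hf.lintegral_kernel] at hpath

theorem IsWaitingTimes.hasMarkovProperty (hZ : IsWaitingTimes a lam e μ Z)
    (h : IsAdmissible a lam) :
    HasMarkovProperty μ (filtration a e hZ.measurable) (process a e Z) h.semigroup := by
  have := hZ.isProbabilityMeasure
  intro s t A hA f
  have hprocess := measurable_process a e hZ.measurable
  rw [← integral_map (f := f) (hprocess _).aemeasurable
      f.continuous.measurable.aestronglyMeasurable, hZ.map_restrict_process_add h s t hA,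
    integral_measure_comp (f.integrable _), integral_map (hprocess _).aemeasurable]
  exact (StronglyMeasurable.integral_kernel_prod_right' (f := fun p : E × E => f p.2)
    (f.continuous.measurable.comp measurable_snd).stronglyMeasurable).aestronglyMeasurable

/-! ### The Feller property -/

section Renewal

variable {a : ℝ} {lam : E → ℝ}

lemma integral_waitKernel (hlam : Continuous lam) (hlam₀ : ∀ x, 0 ≤ lam x) (e : E) (H : ℝ → ℝ) :
    ∫ x, H x ∂(waitKernel a lam e) = ∫ s in Ioi (0 : ℝ), waitDensity a lam e s * H s := by
  have hdens : Measurable (Function.uncurry fun (e : E) (z : Ioi (0 : ℝ)) =>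
      ENNReal.ofReal (waitDensity a lam e z)) :=
    ((continuous_waitDensity hlam).measurable.comp
      (measurable_fst.prodMk (measurable_subtype_coe.comp measurable_snd))).ennreal_ofReal
  rw [waitKernel, Kernel.withDensity_apply _ hdens, Kernel.const_apply,
    integral_withDensity_eq_integral_toReal_smul hdens.of_uncurry_left
      (.of_forall fun _ => ENNReal.ofReal_lt_top)]
  simp only [ENNReal.toReal_ofReal (waitDensity_nonneg hlam₀ _ _), smul_eq_mul]
  exact integral_subtype_comap measurableSet_Ioi fun s => waitDensity a lam e s * H s

namespace IsAdmissible

variable (h : IsAdmissible a lam)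
include h

lemma integrableOn_waitDensity (e : E) : IntegrableOn (waitDensity a lam e) (Ioi 0) := by
  have hc : Continuous (waitDensity a lam e) :=
    (continuous_waitDensity h.continuous).comp (Continuous.prodMk_right e)
  refine ⟨hc.aestronglyMeasurable, ?_⟩
  rw [hasFiniteIntegral_iff_ofReal (.of_forall fun s => waitDensity_nonneg h.nonneg e s),
    h.lintegral_waitDensity_Ioi 0 e]
  exact ENNReal.ofReal_lt_top

lemma integral_waitDensity_Ioi {t : ℝ} (ht : 0 ≤ t) (e : E) :
    ∫ s in Ioi t, waitDensity a lam e s = survival a lam t e := by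
  have hint := (h.integrableOn_waitDensity e).mono_set (Ioi_subset_Ioi ht)
  rw [integral_eq_lintegral_of_nonneg_ae (.of_forall fun s => waitDensity_nonneg h.nonneg e s)
    hint.aestronglyMeasurable, h.lintegral_waitDensity_Ioi,
    ENNReal.toReal_ofReal (survival_pos _ _).le]

lemma integral_waitKernel_ite (e : E) {t : ℝ} (ht : 0 ≤ t) (c : ℝ) {v : ℝ → ℝ}
    (hv : IntervalIntegrable (fun s => waitDensity a lam e s * v s) volume 0 t) :
    ∫ x : Ioi (0 : ℝ), (if t < x then c else v x) ∂(waitKernel a lam e)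
      = survival a lam t e * c + ∫ s in (0 : ℝ)..t, waitDensity a lam e s * v s := by
  let g : ℝ → ℝ := fun s => waitDensity a lam e s * if t < s then c else v s
  have hlate : EqOn g (fun s => waitDensity a lam e s * c) (Ioi t) := fun s hs => by
    simp only [g, if_pos (mem_Ioi.mp hs)]
  have hearly : EqOn g (fun s => waitDensity a lam e s * v s) (Ioc 0 t) := fun s hs => by
    simp only [g, if_neg (not_lt.mpr hs.2)]
  have hlate_int : IntegrableOn g (Ioi t) := IntegrableOn.congr_fun
    (((h.integrableOn_waitDensity e).mono_set (Ioi_subset_Ioi ht)).mul_const c) hlate.symm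
    measurableSet_Ioi
  rw [integral_waitKernel h.continuous h.nonneg e fun s => if t < s then c else v s,
    ← Ioc_union_Ioi_eq_Ioi ht, setIntegral_union (Ioc_disjoint_Ioi le_rfl) measurableSet_Ioi
      (hv.1.congr_fun hearly.symm measurableSet_Ioc) hlate_int, add_comm,
    setIntegral_congr_fun measurableSet_Ioi hlate, integral_mul_const,
    h.integral_waitDensity_Ioi ht, setIntegral_congr_fun measurableSet_Ioc hearly,
    intervalIntegral.integral_of_le ht]

end IsAdmissible

/-- The right-hand side of the renewal equation, obtained by conditioning on the first switch:
`f` is evaluated if there is no switch up to time `p.1`, and `u`, at the remaining time, in the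
state after the switch otherwise. -/
noncomputable def renewal (a : ℝ) (lam f : E → ℝ) (u : ℝ≥0 × E → ℝ) (p : ℝ≥0 × E) : ℝ :=
  survival a lam p.1 p.2 * f (flow a p.1 p.2)
    + ∫ s in (0 : ℝ)..p.1, waitDensity a lam p.2 s * u ((p.1 - s).toNNReal, jump a s p.2)

variable {f : E → ℝ} {u : ℝ≥0 × E → ℝ}

lemma continuous_waitDensity_mul (hlam : Continuous lam) (hu : Continuous u) :
    Continuous fun q : (ℝ≥0 × E) × ℝ =>
      waitDensity a lam q.1.2 q.2 * u ((q.1.1 - q.2).toNNReal, jump a q.2 q.1.2) :=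
  ((continuous_waitDensity hlam).comp
      (by fun_prop : Continuous fun q : (ℝ≥0 × E) × ℝ => (q.1.2, q.2))).mul
    (hu.comp ((continuous_real_toNNReal.comp (by fun_prop)).prodMk
      ((continuous_jump a).comp (by fun_prop : Continuous fun q : (ℝ≥0 × E) × ℝ => (q.2, q.1.2)))))

lemma continuous_renewal (hlam : Continuous lam) (hf : Continuous f) (hu : Continuous u) :
    Continuous (renewal a lam f u) := by
  have hp : Continuous fun p : ℝ≥0 × E => ((p.1 : ℝ), p.2) := by fun_prop
  exact (((continuous_survival hlam).comp hp).mul (hf.comp ((continuous_flow a).comp hp))).add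
    (intervalIntegral.continuous_parametric_intervalIntegral_of_continuous
      (continuous_waitDensity_mul hlam hu) (by fun_prop))

lemma IsAdmissible.integral_seqKernel_eq_renewal (h : IsAdmissible a lam) (hu : Continuous u)
    (t : ℝ≥0) (e : E) {H : (ℕ → Ioi (0 : ℝ)) → ℝ} (hH : Measurable H) {C : ℝ}
    (hC : ∀ z, |H z| ≤ C)
    (hlate : ∀ x : Ioi (0 : ℝ), t < (x : ℝ) → ∀ z, H (seqCons x z) = f (flow a t e))
    (hearly : ∀ x : Ioi (0 : ℝ), (x : ℝ) ≤ t → ∫ z, H (seqCons x z) ∂(h.seqKernel (jump a x e))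
      = u ((t - x : ℝ).toNNReal, jump a x e)) :
    ∫ z, H z ∂(h.seqKernel e) = renewal a lam f u (t, e) := by
  rw [h.integral_seqKernel e hH hC, renewal, ← h.integral_waitKernel_ite e t.coe_nonneg]
  · refine integral_congr_ae (.of_forall fun x => ?_)
    by_cases hx : t < (x : ℝ)
    · simp only [if_pos hx, hlate x hx, integral_const, probReal_univ, one_smul]
    · simp only [if_neg hx, hearly x (not_lt.mp hx)]
  · exact ((continuous_waitDensity_mul h.continuous hu).comp
      (Continuous.prodMk_right (t, e))).intervalIntegrable _ _

end Renewal

lemma measurableSet_lt_switchTime (t : ℝ) (n : ℕ) : MeasurableSet {z | t < switchTime z n} :=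
  measurableSet_lt measurable_const (measurable_switchTime n)

namespace IsAdmissible

variable {a : ℝ} {lam : E → ℝ} (h : IsAdmissible a lam) (f : E →ᵇ ℝ)

lemma integral_semigroup_eq_integral_path (t : ℝ≥0) (e : E) :
    ∫ y, f y ∂(h.semigroup t e) = ∫ z, f (path a e z t) ∂(h.seqKernel e) := by
  rw [semigroup_apply, integral_map (measurable_path a e t).aemeasurable
    f.continuous.measurable.aestronglyMeasurable]

/-- The expectation of `f` at time `p.1` on the event that there are less than `n` switches up to
that time. -/
noncomputable def truncatedMean (n : ℕ) (p : ℝ≥0 × E) : ℝ :=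
  ∫ z in {z | (p.1 : ℝ) < switchTime z n}, f (path a p.2 z p.1) ∂(h.seqKernel p.2)

lemma truncatedMean_zero : h.truncatedMean f 0 = 0 := by
  funext p
  simp only [truncatedMean, switchTime_zero, not_lt.mpr p.1.coe_nonneg, ofPred_false,
    Measure.restrict_empty, integral_zero_measure, Pi.zero_apply]

lemma truncatedMean_succ {n : ℕ} (hn : Continuous (h.truncatedMean f n)) :
    h.truncatedMean f (n + 1) = renewal a lam f (h.truncatedMean f n) := by
  funext ⟨t, e⟩
  rw [truncatedMean, ← integral_indicator (measurableSet_lt_switchTime t (n + 1))]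
  refine h.integral_seqKernel_eq_renewal hn t e (C := ‖f‖)
    ((f.continuous.measurable.comp (measurable_path a e t)).indicator
      (measurableSet_lt_switchTime t (n + 1)))
    (fun z => (norm_indicator_le_norm_self (fun z => f (path a e z t)) z).trans
      (f.norm_coe_le_norm _))
    (fun x hx z => ?_) fun x hx => ?_
  · rw [indicator_of_mem, path_eq_flow (by simpa using hx)]
    rw [mem_ofPred_eq, switchTime_seqCons]
    exact hx.trans_le (le_add_of_nonneg_right switchTime_nonneg)
  · have hr : ((t - x : ℝ).toNNReal : ℝ) = t - x := Real.coe_toNNReal _ (sub_nonneg.mpr hx)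
    rw [truncatedMean, ← integral_indicator (measurableSet_lt_switchTime _ n)]
    refine integral_congr_ae (.of_forall fun z => ?_)
    simp only [indicator_apply, mem_ofPred_eq, switchTime_seqCons, hr, sub_lt_iff_lt_add']
    refine if_ctx_congr Iff.rfl (fun hz => ?_) fun _ => rfl
    rw [path_seqCons hr (by rwa [hr, sub_lt_iff_lt_add'])]

lemma continuous_truncatedMean (n : ℕ) : Continuous (h.truncatedMean f n) := by
  induction n with
  | zero => exact h.truncatedMean_zero f ▸ continuous_zero
  | succ n ih => exact h.truncatedMean_succ f ih ▸ continuous_renewal h.continuous f.continuous ih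

lemma abs_integral_semigroup_sub_truncatedMean_le (n : ℕ) (p : ℝ≥0 × E) :
    |∫ y, f y ∂(h.semigroup p.1 p.2) - h.truncatedMean f n p|
      ≤ ‖f‖ * (h.seqKernel p.2).real {z | switchTime z n ≤ p.1} := by
  have hint : Integrable (fun z => f (path a p.2 z p.1)) (h.seqKernel p.2) :=
    .of_bound (f.continuous.measurable.comp (measurable_path a p.2 p.1)).aestronglyMeasurable ‖f‖
      (.of_forall fun z => f.norm_coe_le_norm _)
  have hcompl : {z | switchTime z n ≤ p.1} = {z | (p.1 : ℝ) < switchTime z n}ᶜ := by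
    ext z; exact (not_lt (α := ℝ)).symm
  rw [integral_semigroup_eq_integral_path, truncatedMean, hcompl,
    ← integral_add_compl (measurableSet_lt_switchTime p.1 n) hint, add_sub_cancel_left]
  exact norm_setIntegral_le_of_norm_le_const (measure_lt_top _ _) fun z _ => f.norm_coe_le_norm _

/-- The truncated expectations are continuous, and since the rate is locally bounded they converge
locally uniformly. -/
theorem continuous_integral_semigroup :
    Continuous fun p : ℝ≥0 × E => ∫ y, f y ∂(h.semigroup p.1 p.2) := by
  refine continuous_of_locally_uniform_approx_of_continuousAt fun p₀ V hV => ?_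
  obtain ⟨ε, hε, hεV⟩ := Metric.mem_uniformity_dist.mp hV
  set T : ℝ := p₀.1 + 1
  set R : ℝ := |p₀.2.1| + 1 + |a| * T
  obtain ⟨M, hM0, hM⟩ := exists_rate_le h.continuous R
  have hlim : Tendsto (fun n : ℕ => ‖f‖ * ((M * T) ^ n / n.factorial)) atTop (𝓝 0) := by
    simpa using (FloorSemiring.tendsto_pow_div_factorial_atTop (M * T)).const_mul ‖f‖
  obtain ⟨n, hn⟩ := (hlim.eventually (gt_mem_nhds hε)).exists
  have htime : ∀ᶠ p : ℝ≥0 × E in 𝓝 p₀, (p.1 : ℝ) < T :=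
    ((by fun_prop : Continuous fun p : ℝ≥0 × E => (p.1 : ℝ)).tendsto p₀).eventually
      (gt_mem_nhds (lt_add_one _))
  have hspace : ∀ᶠ p : ℝ≥0 × E in 𝓝 p₀, |p.2.1| < |p₀.2.1| + 1 :=
    ((by fun_prop : Continuous fun p : ℝ≥0 × E => |p.2.1|).tendsto p₀).eventually
      (gt_mem_nhds (lt_add_one _))
  refine ⟨_, htime.and hspace, h.truncatedMean f n, (h.continuous_truncatedMean f n).continuousAt,
    fun p ⟨hpT, hpR⟩ => hεV ?_⟩
  have hreach : |p.2.1| + |a| * p.1 ≤ R :=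
    add_le_add hpR.le (by gcongr)
  calc |∫ y, f y ∂(h.semigroup p.1 p.2) - h.truncatedMean f n p|
      ≤ ‖f‖ * (h.seqKernel p.2).real {z | switchTime z n ≤ p.1} :=
        h.abs_integral_semigroup_sub_truncatedMean_le f n p
    _ ≤ ‖f‖ * ((M * p.1) ^ n / n.factorial) := by
        gcongr
        exact ENNReal.toReal_le_of_le_ofReal (by positivity)
          (h.seqKernel_switchTime_le hM0 hM n p.1.coe_nonneg hreach)
    _ ≤ ‖f‖ * ((M * T) ^ n / n.factorial) := by gcongr
    _ < ε := hn

theorem integral_semigroup_eq_renewal (t : ℝ≥0) (e : E) :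
    ∫ y, f y ∂(h.semigroup t e)
      = renewal a lam f (fun p => ∫ y, f y ∂(h.semigroup p.1 p.2)) (t, e) := by
  rw [h.integral_semigroup_eq_integral_path]
  refine h.integral_seqKernel_eq_renewal (h.continuous_integral_semigroup f) t e (C := ‖f‖)
    (f.continuous.measurable.comp (measurable_path a e t)) (fun z => f.norm_coe_le_norm _)
    (fun x hx z => ?_) fun x hx => ?_
  · rw [path_eq_flow (by simpa using hx)]
  · have hr : ((t - x : ℝ).toNNReal : ℝ) = t - x := Real.coe_toNNReal _ (sub_nonneg.mpr hx)
    rw [h.integral_semigroup_eq_integral_path]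
    refine integral_congr_ae ?_
    filter_upwards [h.ae_exists_lt_switchTime (jump a x e) (t - x : ℝ).toNNReal.coe_nonneg]
      with z ⟨m, hm⟩
    rw [path_seqCons hr hm]

end IsAdmissible

theorem IsWaitingTimes.isStrongMarkov {Ω : Type*} [MeasurableSpace Ω] {μ : Measure Ω}
    {a : ℝ} {lam : E → ℝ} {Z : ℕ → Ω → Ioi (0 : ℝ)} {e : E} (hZ : IsWaitingTimes a lam e μ Z)
    (h : IsAdmissible a lam) :
    IsStrongMarkov μ (filtration a e hZ.measurable) (process a e Z) h.semigroup := by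
  have := hZ.isProbabilityMeasure
  have hfeller : ∀ (t : ℝ≥0) (f : E →ᵇ ℝ), Continuous fun x => ∫ z, f z ∂(h.semigroup t x) :=
    fun t f => (h.continuous_integral_semigroup f).comp (Continuous.prodMk_right t)
  have hadapted : ∀ t, Measurable[filtration a e hZ.measurable t] (process a e Z t) := fun t =>
    (Filtration.stronglyAdapted_natural
      fun t => (measurable_process a e hZ.measurable t).stronglyMeasurable) t |>.measurable
  exact isStrongMarkov_of_feller (fun t => inferInstance) hfeller hadapted
    (fun ω t => path_rightContinuous a e _ t) (hZ.hasMarkovProperty h)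

/-! ### Contraction semigroups on a Banach space -/

section ContractionSemigroup

variable {X : Type*} [NormedAddCommGroup X] [NormedSpace ℝ X]

/-- `T` is a strongly continuous semigroup of linear contractions on `X`. -/
structure IsContractionSemigroup (T : ℝ≥0 → X →L[ℝ] X) : Prop where
  zero : T 0 = .id ℝ X
  add : ∀ s t, T (s + t) = T s ∘L T t
  norm_apply_le : ∀ t x, ‖T t x‖ ≤ ‖x‖
  tendsto_zero : ∀ x, Tendsto (fun t => T t x) (𝓝 0) (𝓝 x)

/-- The resolvent at `1` of the generator of a semigroup `T`. -/
noncomputable def resolventOne (T : ℝ≥0 → X →L[ℝ] X) (x : X) : X :=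
  ∫ t in Ioi (0 : ℝ), Real.exp (-t) • T t.toNNReal x

namespace IsContractionSemigroup

variable {T : ℝ≥0 → X →L[ℝ] X} (hT : IsContractionSemigroup T)
include hT

lemma dist_apply_le (s t : ℝ≥0) (x : X) : dist (T s x) (T t x) ≤ dist (T (nndist s t) x) x := by
  wlog hst : s ≤ t generalizing s t
  · rw [dist_comm, nndist_comm]
    exact this t s (le_of_not_ge hst)
  have hadd : T t x = T s (T (nndist s t) x) := by
    rw [← ContinuousLinearMap.comp_apply, ← hT.add, nndist_comm, NNReal.nndist_eq,
      tsub_eq_zero_of_le hst, max_eq_left zero_le, add_tsub_cancel_of_le hst]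
  rw [hadd, dist_comm, dist_eq_norm, dist_eq_norm, ← map_sub]
  exact hT.norm_apply_le s _

lemma continuous_apply (x : X) : Continuous fun t => T t x := by
  refine continuous_iff_continuousAt.mpr fun t => tendsto_iff_dist_tendsto_zero.mpr ?_
  have hnndist : Tendsto (fun s => nndist s t) (𝓝 t) (𝓝 0) :=
    (continuous_id.nndist continuous_const).tendsto' t 0 (nndist_self t)
  exact squeeze_zero (fun _ => dist_nonneg) (fun s => hT.dist_apply_le s t x)
    (tendsto_iff_dist_tendsto_zero.mp ((hT.tendsto_zero x).comp hnndist))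

lemma continuous_exp_smul (x : X) : Continuous fun t : ℝ => Real.exp (-t) • T t.toNNReal x :=
  (by fun_prop : Continuous fun t : ℝ => Real.exp (-t)).smul
    ((hT.continuous_apply x).comp continuous_real_toNNReal)

lemma norm_exp_smul_le (x : X) (t : ℝ) :
    ‖Real.exp (-t) • T t.toNNReal x‖ ≤ Real.exp (-t) * ‖x‖ := by
  rw [norm_smul, Real.norm_of_nonneg (Real.exp_pos _).le]
  exact mul_le_mul_of_nonneg_left (hT.norm_apply_le _ x) (Real.exp_pos _).le

lemma integrableOn_exp_smul (x : X) (c : ℝ) :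
    IntegrableOn (fun t : ℝ => Real.exp (-t) • T t.toNNReal x) (Ioi c) :=
  Integrable.mono' ((integrableOn_exp_neg_Ioi c).mul_const ‖x‖)
    (hT.continuous_exp_smul x).aestronglyMeasurable (.of_forall (hT.norm_exp_smul_le x))

lemma dist_resolventOne_le (x y : X) : dist (resolventOne T x) (resolventOne T y) ≤ dist x y := by
  have hsub : resolventOne T x - resolventOne T y = resolventOne T (x - y) := by
    simp only [resolventOne, map_sub, smul_sub]
    exact (integral_sub (hT.integrableOn_exp_smul x 0) (hT.integrableOn_exp_smul y 0)).symm
  calc dist (resolventOne T x) (resolventOne T y) = ‖resolventOne T (x - y)‖ := by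
        rw [dist_eq_norm, hsub]
    _ ≤ ∫ t in Ioi (0 : ℝ), Real.exp (-t) * ‖x - y‖ :=
        norm_integral_le_of_norm_le ((integrableOn_exp_neg_Ioi 0).mul_const _)
          (.of_forall (hT.norm_exp_smul_le _))
    _ = dist x y := by rw [integral_mul_const, integral_exp_neg_Ioi_zero, one_mul, dist_eq_norm]

lemma continuous_resolventOne : Continuous (resolventOne T) :=
  (LipschitzWith.of_dist_le_mul (K := 1) fun x y => by
    rw [NNReal.coe_one, one_mul]; exact hT.dist_resolventOne_le x y).continuous

variable [CompleteSpace X]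

lemma apply_resolventOne (t : ℝ≥0) (x : X) :
    T t (resolventOne T x) = Real.exp t •
      (resolventOne T x - ∫ r in (0 : ℝ)..t, Real.exp (-r) • T r.toNNReal x) := by
  set u : ℝ → X := fun r => Real.exp (-r) • T r.toNNReal x
  have hint := hT.integrableOn_exp_smul x
  have hshift : ∀ s ∈ Ioi (0 : ℝ), T t (u s) = Real.exp t • u (s + t) := fun s hs => by
    have hst : (s + t).toNNReal = t + s.toNNReal := by
      rw [Real.toNNReal_add (mem_Ioi.mp hs).le t.coe_nonneg, Real.toNNReal_coe, add_comm]
    simp only [u, map_smul, smul_smul, hst, hT.add, ContinuousLinearMap.comp_apply,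
      ← Real.exp_add]
    ring_nf
  calc T t (resolventOne T x) = ∫ s in Ioi (0 : ℝ), T t (u s) :=
        ((T t).integral_comp_comm (hint 0)).symm
    _ = Real.exp t • ∫ s in Ioi (0 : ℝ), u (s + t) := by
        rw [setIntegral_congr_fun measurableSet_Ioi hshift, integral_smul]
    _ = Real.exp t • ∫ s in Ioi (t : ℝ), u s := by
        have hpre := (measurePreserving_add_right volume (t : ℝ)).setIntegral_preimage_emb
          (measurableEmbedding_addRight _) u (Ioi (t : ℝ))
        rw [preimage_add_const_Ioi, sub_self] at hpre
        rw [hpre]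
    _ = Real.exp t • (resolventOne T x - ∫ r in (0 : ℝ)..t, u r) := by
        rw [resolventOne, ← intervalIntegral.integral_interval_add_Ioi (hint 0) (hint t),
          add_sub_cancel_left]

theorem tendsto_slope_resolventOne (x : X) :
    Tendsto (fun t : ℝ≥0 => (t : ℝ)⁻¹ • (T t (resolventOne T x) - resolventOne T x)) (𝓝[>] 0)
      (𝓝 (resolventOne T x - x)) := by
  set w := resolventOne T x
  set φ : ℝ → X := fun t => Real.exp t • (w - ∫ r in (0 : ℝ)..t, Real.exp (-r) • T r.toNNReal x)
  have hφ0 : φ 0 = w := by simp [φ]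
  have hφ : HasDerivAt φ (w - x) 0 := by
    refine ((Real.hasDerivAt_exp 0).smul (((hT.continuous_exp_smul x).integral_hasStrictDerivAt
      0 0).hasDerivAt.const_sub w)).congr_deriv ?_
    simp [hT.zero, sub_eq_neg_add]
  have hcoe : Tendsto (fun t : ℝ≥0 => (t : ℝ)) (𝓝[>] 0) (𝓝[≠] 0) :=
    tendsto_nhdsWithin_iff.mpr
      ⟨(NNReal.continuous_coe.tendsto' 0 0 rfl).mono_left nhdsWithin_le_nhds,
        eventually_mem_nhdsWithin.mono fun t ht => NNReal.coe_ne_zero.mpr (ne_of_gt ht)⟩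
  refine ((hasDerivAt_iff_tendsto_slope.mp hφ).comp hcoe).congr fun t => ?_
  rw [Function.comp_apply, slope_def_module, sub_zero, hφ0, hT.apply_resolventOne]

end IsContractionSemigroup

end ContractionSemigroup

/-! ### The semigroup on `C₀(E)` -/

lemma cocompact_eq_comap : cocompact E = comap (fun e : E => |e.1|) atTop := by
  have hreal : cocompact ℝ = comap (fun y : ℝ => |y|) atTop := by
    rw [← Metric.cobounded_eq_cocompact, ← comap_norm_atTop]; rfl
  rw [← coprod_cocompact, Filter.coprod, cocompact_eq_bot (X := ℤˣ), comap_bot, sup_bot_eq, hreal,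
    comap_comap]
  rfl

lemma tendsto_cocompact_zero_iff {f : E → ℝ} :
    Tendsto f (cocompact E) (𝓝 0) ↔ ∀ ε > 0, ∃ R, ∀ e : E, R ≤ |e.1| → |f e| ≤ ε := by
  rw [cocompact_eq_comap, (atTop_basis.comap _).tendsto_iff Metric.nhds_basis_closedBall]
  simp only [true_and, mem_preimage, mem_Ici, mem_closedBall_zero_iff, Real.norm_eq_abs]

lemma norm_apply_le_norm (f : C₀(E, ℝ)) (e : E) : ‖f e‖ ≤ ‖f‖ := f.toBCF.norm_coe_le_norm e

lemma norm_le_of_norm_apply_le {f : C₀(E, ℝ)} {C : ℝ} (hC : 0 ≤ C) (hf : ∀ e, ‖f e‖ ≤ C) :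
    ‖f‖ ≤ C :=
  (BoundedContinuousFunction.norm_le hC (f := f.toBCF)).mpr hf

lemma integrable_zeroAtInfty (f : C₀(E, ℝ)) (μ : Measure E) [IsFiniteMeasure μ] :
    Integrable f μ :=
  f.toBCF.integrable μ

namespace IsAdmissible

variable {a : ℝ} {lam : E → ℝ} (h : IsAdmissible a lam)

lemma exists_forall_abs_integral_semigroup_le (f : C₀(E, ℝ)) {ε : ℝ} (hε : 0 < ε) :
    ∃ R, ∀ (t : ℝ≥0) (e : E), R + |a| * t ≤ |e.1| → |∫ y, f y ∂(h.semigroup t e)| ≤ ε := by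
  obtain ⟨R, hR⟩ := tendsto_cocompact_zero_iff.mp f.zero_at_infty' ε hε
  refine ⟨R, fun t e he => ?_⟩
  have hle : ∀ z, ‖f (path a e z t)‖ ≤ ε := fun z => by
    refine hR _ ?_
    have hdist := abs_path_sub_le a e z t
    have htri := abs_sub_abs_le_abs_sub e.1 (path a e z t).1
    rw [abs_sub_comm] at htri
    linarith
  calc |∫ y, f y ∂(h.semigroup t e)| = |∫ z, f (path a e z t) ∂(h.seqKernel e)| :=
        congrArg abs (h.integral_semigroup_eq_integral_path f.toBCF t e)
    _ ≤ ε := by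
        simpa using norm_integral_le_of_norm_le_const (μ := h.seqKernel e) (.of_forall hle)

lemma tendsto_integral_semigroup_cocompact (f : C₀(E, ℝ)) (t : ℝ≥0) :
    Tendsto (fun e => ∫ y, f y ∂(h.semigroup t e)) (cocompact E) (𝓝 0) := by
  refine tendsto_cocompact_zero_iff.mpr fun ε hε => ?_
  obtain ⟨R, hR⟩ := h.exists_forall_abs_integral_semigroup_le f hε
  exact ⟨R + |a| * t, fun e he => hR t e he⟩

/-- The Feller semigroup on `C₀(E)` induced by the transition kernels. -/
noncomputable def fellerSemigroup (t : ℝ≥0) : C₀(E, ℝ) →L[ℝ] C₀(E, ℝ) :=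
  LinearMap.mkContinuous
    { toFun f := ⟨⟨fun e => ∫ y, f y ∂(h.semigroup t e),
          (h.continuous_integral_semigroup f.toBCF).comp (Continuous.prodMk_right t)⟩,
        h.tendsto_integral_semigroup_cocompact f t⟩
      map_add' f g := by
        ext e
        exact integral_add (integrable_zeroAtInfty f _) (integrable_zeroAtInfty g _)
      map_smul' c f := by
        ext e
        exact integral_const_mul c f }
    1 fun f => by
      rw [one_mul]
      refine norm_le_of_norm_apply_le (norm_nonneg f) fun e => ?_
      exact (norm_integral_le_of_norm_le_const (.of_forall (norm_apply_le_norm f))).trans_eq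
        (by rw [probReal_univ, mul_one])

lemma fellerSemigroup_apply (t : ℝ≥0) (f : C₀(E, ℝ)) (e : E) :
    h.fellerSemigroup t f e = ∫ y, f y ∂(h.semigroup t e) := rfl

lemma norm_fellerSemigroup_apply_le (t : ℝ≥0) (f : C₀(E, ℝ)) : ‖h.fellerSemigroup t f‖ ≤ ‖f‖ :=
  (ContinuousLinearMap.le_of_opNorm_le _ (LinearMap.mkContinuous_norm_le _ zero_le_one _) f).trans
    (one_mul _).le

lemma fellerSemigroup_zero : h.fellerSemigroup 0 = .id ℝ C₀(E, ℝ) := by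
  ext f e
  rw [fellerSemigroup_apply, h.isMarkovSemigroup.zero, Kernel.id_apply, integral_dirac]
  rfl

lemma fellerSemigroup_add (s t : ℝ≥0) :
    h.fellerSemigroup (s + t) = h.fellerSemigroup s ∘L h.fellerSemigroup t := by
  ext f e
  have hint := integrable_zeroAtInfty f (h.semigroup (s + t) e)
  rw [h.isMarkovSemigroup.add] at hint
  rw [fellerSemigroup_apply, h.isMarkovSemigroup.add, Kernel.integral_comp hint]
  rfl

/-- Pointwise convergence is uniform on compact sets by joint continuity, and outside a large
compact set both sides are small since the process moves with bounded speed. -/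
lemma tendsto_fellerSemigroup_zero (f : C₀(E, ℝ)) :
    Tendsto (fun t => h.fellerSemigroup t f) (𝓝 0) (𝓝 f) := by
  have hf : ∀ e, ∫ y, f y ∂(h.semigroup 0 e) = f e := fun e => by
    rw [← fellerSemigroup_apply, fellerSemigroup_zero]; rfl
  refine ZeroAtInftyContinuousMap.tendsto_iff_tendstoUniformly.mpr
    (Metric.tendstoUniformly_iff.mpr fun ε hε => ?_)
  obtain ⟨R, hR⟩ := h.exists_forall_abs_integral_semigroup_le f (by positivity : 0 < ε / 3)
  have hK : IsCompact (Icc (-(R + |a|)) (R + |a|) ×ˢ (univ : Set ℤˣ)) :=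
    isCompact_Icc.prod isCompact_univ
  obtain ⟨v, hv, hvK⟩ := hK.mem_uniformity_of_prod
    (f := fun t e => ∫ y, f y ∂(h.semigroup t e)) (s := univ) (q := 0)
    (h.continuous_integral_semigroup f.toBCF).continuousOn (mem_univ _)
    (Metric.dist_mem_uniformity hε)
  rw [nhdsWithin_univ] at hv
  filter_upwards [hv, gt_mem_nhds one_pos] with t htv ht1 e
  rw [dist_comm, fellerSemigroup_apply]
  by_cases he : |e.1| ≤ R + |a|
  · rw [← hf]
    exact hvK t htv e ⟨abs_le.mp he, mem_univ _⟩
  · have hat : |a| * t ≤ |a| := mul_le_of_le_one_right (abs_nonneg a) (by exact_mod_cast ht1.le)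
    have ht := hR t e (by linarith)
    have h0 := hR 0 e (by rw [NNReal.coe_zero, mul_zero]; linarith [abs_nonneg a])
    rw [hf] at h0
    exact (abs_sub _ _).trans_lt (by linarith)

theorem isContractionSemigroup_fellerSemigroup : IsContractionSemigroup h.fellerSemigroup where
  zero := h.fellerSemigroup_zero
  add := h.fellerSemigroup_add
  norm_apply_le := h.norm_fellerSemigroup_apply_le
  tendsto_zero := h.tendsto_fellerSemigroup_zero

lemma mem_generatorGraph_iff {p : C₀(E, ℝ) × C₀(E, ℝ)} :
    p ∈ generatorGraph h.semigroup ↔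
      Tendsto (fun t : ℝ≥0 => (t : ℝ)⁻¹ • (h.fellerSemigroup t p.1 - p.1)) (𝓝[>] 0) (𝓝 p.2) := by
  rw [ZeroAtInftyContinuousMap.tendsto_iff_tendstoUniformly, generatorGraph, mem_ofPred_eq]
  refine iff_of_eq (congrArg (TendstoUniformly · _ _) ?_)
  funext t e
  exact div_eq_inv_mul _ _

end IsAdmissible

/-! ### The generator -/

section Derivatives

variable {F : Type*} [NormedAddCommGroup F] [NormedSpace ℝ F] [CompleteSpace F]

lemma hasDerivAt_integral_of_continuous {k : ℝ → ℝ → F} (hk : Continuous (Function.uncurry k)) :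
    HasDerivAt (fun t => ∫ s in (0 : ℝ)..t, k t s) (k 0 0) 0 := by
  have hscale : ∀ t, ∫ s in (0 : ℝ)..t, k t s = t • ∫ r in (0 : ℝ)..1, k t (t * r) := fun t => by
    rw [intervalIntegral.smul_integral_comp_mul_left, mul_zero, mul_one]
  have hcont : Continuous fun t => ∫ r in (0 : ℝ)..1, k t (t * r) :=
    intervalIntegral.continuous_parametric_intervalIntegral_of_continuous'
      (f := fun t r => k t (t * r))
      (hk.comp (by fun_prop : Continuous fun q : ℝ × ℝ => (q.1, q.1 * q.2))) 0 1
  refine hasDerivAt_iff_tendsto_slope_zero.mpr ?_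
  refine ((hcont.tendsto' 0 _ (by simp)).mono_left nhdsWithin_le_nhds).congr' ?_
  filter_upwards [eventually_mem_nhdsWithin] with t ht
  rw [zero_add, intervalIntegral.integral_same, sub_zero, hscale, inv_smul_smul₀ ht]

lemma hasDerivAt_of_hasDerivWithinAt_Ici {f f' : ℝ → F} (hf : Continuous f)
    (hf' : Continuous f') (hderiv : ∀ t, HasDerivWithinAt f (f' t) (Ici t) t) (t : ℝ) :
    HasDerivAt f (f' t) t := by
  have hint : ∀ u, f u = f t + ∫ s in t..u, f' s := fun u => by
    rw [intervalIntegral.integral_eq_sub_of_hasDeriv_right hf.continuousOn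
      (fun s _ => (hderiv s).mono Ioi_subset_Ici_self) (hf'.intervalIntegrable t u),
      add_sub_cancel]
  exact ((hf'.integral_hasStrictDerivAt t t).hasDerivAt.const_add (f t)).congr_of_eventuallyEq
    (.of_forall hint)

end Derivatives

section Generator

variable {a : ℝ} {lam : E → ℝ}

lemma hasDerivAt_of_hasDerivAt_flow (ha : a ≠ 0) {w : E → ℝ} {e : E} {d : ℝ}
    (hw : HasDerivAt (fun t : ℝ => w (flow a t e)) d 0) :
    HasDerivAt (fun y : ℝ => w (y, e.2)) (d * (sgn e.2 / a)) e.1 := by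
  have htime : HasDerivAt (fun y : ℝ => (y - e.1) * (sgn e.2 / a)) (sgn e.2 / a) e.1 := by
    simpa using ((hasDerivAt_id e.1).sub_const e.1).mul_const (sgn e.2 / a)
  have hflow : ∀ y : ℝ, flow a ((y - e.1) * (sgn e.2 / a)) e = (y, e.2) := fun y => by
    refine Prod.ext ?_ rfl
    simp only [flow]
    field_simp
    linear_combination (y - e.1) * sgn_mul_self e.2
  have hcomp := HasDerivAt.comp e.1 (by rwa [sub_self, zero_mul]) htime
  simpa only [Function.comp_def, hflow] using hcomp

lemma mem_graph_L_iff {p : C₀(E, ℝ) × C₀(E, ℝ)} :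
    p ∈ (L a lam).graph ↔ InDomain a lam p.1 ∧ genExpr a lam p.1 = p.2 := by
  rw [LinearPMap.mem_graph_iff]
  constructor
  · rintro ⟨φ, hφ, hLφ⟩
    exact ⟨hφ ▸ φ.2, by rw [← hφ, ← hLφ]; rfl⟩
  · rintro ⟨hdom, heq⟩
    exact ⟨⟨p.1, hdom⟩, rfl, DFunLike.coe_injective heq⟩

lemma mem_graph_L_of_hasDerivAt (ha : a ≠ 0) (hlam : Continuous lam) {p : C₀(E, ℝ) × C₀(E, ℝ)}
    (hderiv : ∀ e, HasDerivAt (fun t => p.1 (flow a t e))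
      (p.2 e - lam e * (p.1 (e.1, -e.2) - p.1 e)) 0) :
    p ∈ (L a lam).graph := by
  have hspace : ∀ e, HasDerivAt (fun y => p.1 (y, e.2))
      ((p.2 e - lam e * (p.1 (e.1, -e.2) - p.1 e)) * (sgn e.2 / a)) e.1 := fun e =>
    hasDerivAt_of_hasDerivAt_flow ha (hderiv e)
  have heq : genExpr a lam p.1 = p.2 := by
    funext e
    rw [genExpr, (hspace e).deriv]
    field_simp
    linear_combination (p.2 e - lam e * (p.1 (e.1, -e.2) - p.1 e)) * sgn_mul_self e.2
  refine mem_graph_L_iff.mpr ⟨⟨fun j => contDiff_one_iff_deriv.mpr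
    ⟨fun y => (hspace (y, j)).differentiableAt, ?_⟩, ?_, ?_⟩, heq⟩
  · have hj : deriv (fun y => p.1 (y, j)) = _ := funext fun y => (hspace (y, j)).deriv
    rw [hj]
    have hp1 := map_continuous p.1
    have hp2 := map_continuous p.2
    fun_prop
  · exact heq ▸ map_continuous p.2
  · exact heq ▸ p.2.zero_at_infty'

namespace IsAdmissible

variable (h : IsAdmissible a lam) {p : C₀(E, ℝ) × C₀(E, ℝ)}
include h

lemma hasDerivWithinAt_fellerSemigroup (hp : p ∈ generatorGraph h.semigroup) (e : E) :
    HasDerivWithinAt (fun t : ℝ => h.fellerSemigroup t.toNNReal p.1 e) (p.2 e) (Ici 0) 0 := by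
  have htoNNReal : Tendsto Real.toNNReal (𝓝[>] 0) (𝓝[>] 0) :=
    tendsto_nhdsWithin_iff.mpr ⟨(continuous_real_toNNReal.tendsto' 0 0 Real.toNNReal_zero).mono_left
      nhdsWithin_le_nhds, eventually_mem_nhdsWithin.mono fun _ => Real.toNNReal_pos.mpr⟩
  rw [← hasDerivWithinAt_Ioi_iff_Ici, hasDerivWithinAt_iff_tendsto_slope' self_notMem_Ioi]
  refine ((TendstoUniformly.tendsto_at hp e).comp htoNNReal).congr' ?_
  filter_upwards [eventually_mem_nhdsWithin] with t ht
  rw [slope_def_field, Real.toNNReal_zero, h.fellerSemigroup_zero, sub_zero, Function.comp_apply,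
    Real.coe_toNNReal t (mem_Ioi.mp ht).le]
  rfl

/-- In the renewal equation, the terms other than `p.1 (flow a t e)` are differentiable from the
right at `t = 0`. -/
lemma hasDerivWithinAt_flow (hp : p ∈ generatorGraph h.semigroup) (e : E) :
    HasDerivWithinAt (fun t => p.1 (flow a t e)) (p.2 e - lam e * (p.1 (e.1, -e.2) - p.1 e))
      (Ici 0) 0 := by
  set u : ℝ≥0 × E → ℝ := fun q => h.fellerSemigroup q.1 p.1 q.2
  set k : ℝ → ℝ → ℝ := fun t s =>
    waitDensity a lam e s * u ((t.toNNReal - s).toNNReal, jump a s e)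
  have hk : Continuous (Function.uncurry k) :=
    (continuous_waitDensity_mul h.continuous (h.continuous_integral_semigroup p.1.toBCF)).comp
      (((continuous_real_toNNReal.comp continuous_fst).prodMk continuous_const).prodMk
        continuous_snd)
  have hrenewal : ∀ t ∈ Ici (0 : ℝ), p.1 (flow a t e)
      = (u (t.toNNReal, e) - ∫ s in (0 : ℝ)..t, k t s) / survival a lam t e := fun t ht => by
    have heq : u (t.toNNReal, e) = renewal a lam p.1 u (t.toNNReal, e) :=
      h.integral_semigroup_eq_renewal p.1.toBCF _ e
    rw [eq_div_iff (survival_pos t e).ne', heq, renewal, Real.coe_toNNReal t ht]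
    simp only [k, Real.coe_toNNReal t ht]
    ring
  have hderiv := ((h.hasDerivWithinAt_fellerSemigroup hp e).sub
    (hasDerivAt_integral_of_continuous hk).hasDerivWithinAt).div
    (hasDerivAt_survival (a := a) h.continuous 0 e).hasDerivWithinAt (survival_pos 0 e).ne'
  refine (hderiv.congr hrenewal (hrenewal 0 self_mem_Ici)).congr_deriv ?_
  have hP0 : h.fellerSemigroup 0 p.1 = p.1 := by rw [h.fellerSemigroup_zero]; rfl
  have hk0 : k 0 0 = lam e * p.1 (e.1, -e.2) := by
    simp [k, u, hP0, waitDensity, flow_zero, survival_zero, jump]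
  simp only [Pi.sub_apply, hk0, hP0, survival_zero, flow_zero, Real.toNNReal_zero,
    intervalIntegral.integral_same]
  ring

theorem generatorGraph_semigroup_subset (ha : a ≠ 0) :
    generatorGraph h.semigroup ⊆ (L a lam).graph := by
  intro p hp
  have hp1 := map_continuous p.1
  have hp2 := map_continuous p.2
  have hlam := h.continuous
  refine mem_graph_L_of_hasDerivAt ha hlam fun e => ?_
  have hflow := continuous_flow_left a e
  have hright : ∀ t, HasDerivWithinAt (fun t => p.1 (flow a t e))
      (p.2 (flow a t e) - lam (flow a t e) *
        (p.1 ((flow a t e).1, -(flow a t e).2) - p.1 (flow a t e))) (Ici t) t := fun t => by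
    have hshift : HasDerivWithinAt (fun s => s - t) 1 (Ici t) t :=
      (hasDerivWithinAt_id t _).sub_const t
    simpa [Function.comp_def, flow_flow] using
      (h.hasDerivWithinAt_flow hp (flow a t e)).comp_of_eq t hshift
        (fun s hs => mem_Ici.mpr (sub_nonneg.mpr hs)) (sub_self t).symm
  have hderiv := hasDerivAt_of_hasDerivWithinAt_Ici (by fun_prop) (by fun_prop) hright 0
  rwa [flow_zero] at hderiv

end IsAdmissible

/-- The positive maximum principle: at a maximum of `χ` the derivative vanishes and the jump term is
nonpositive. -/
lemma nonpos_of_genExpr_eq (hlam : ∀ x, 0 ≤ lam x) {χ : C₀(E, ℝ)} (hχ : genExpr a lam χ = χ)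
    (e : E) : χ e ≤ 0 := by
  by_contra! he
  obtain ⟨x, hx⟩ := (map_continuous χ).exists_forall_ge' e
    ((χ.zero_at_infty'.eventually_lt_const he).mono fun _ => le_of_lt)
  have hderiv : deriv (fun y : ℝ => χ (y, x.2)) x.1 = 0 :=
    IsLocalMax.deriv_eq_zero (.of_forall fun y => hx (y, x.2))
  have hmax : χ x ≤ 0 := by
    rw [← congrFun hχ x, genExpr, hderiv, mul_zero, zero_add]
    exact mul_nonpos_of_nonneg_of_nonpos (hlam x) (sub_nonpos.mpr (hx _))
  exact (he.trans_le (hx e)).not_ge hmax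

lemma eq_zero_of_genExpr_eq (hlam : ∀ x, 0 ≤ lam x) {χ : C₀(E, ℝ)} (hχ : genExpr a lam χ = χ) :
    χ = 0 := by
  have hneg : genExpr a lam (-χ : C₀(E, ℝ)) = (-χ : C₀(E, ℝ)) := by
    have hsmul := genExpr_smul (a := a) (lam := lam) (φ := χ) (-1)
    rwa [hχ, neg_one_smul] at hsmul
  ext e
  have hnonneg := nonpos_of_genExpr_eq hlam hneg e
  rw [ZeroAtInftyContinuousMap.neg_apply, neg_nonpos] at hnonneg
  exact le_antisymm (nonpos_of_genExpr_eq hlam hχ e) hnonneg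

namespace IsAdmissible

variable (h : IsAdmissible a lam)

lemma resolventOne_mem_generatorGraph (f : C₀(E, ℝ)) :
    (resolventOne h.fellerSemigroup f, resolventOne h.fellerSemigroup f - f)
      ∈ generatorGraph h.semigroup :=
  h.mem_generatorGraph_iff.mpr
    (h.isContractionSemigroup_fellerSemigroup.tendsto_slope_resolventOne f)

lemma mem_generatorGraph_of_resolventOne_eq {p : C₀(E, ℝ) × C₀(E, ℝ)}
    (hp : resolventOne h.fellerSemigroup (p.1 - p.2) = p.1) : p ∈ generatorGraph h.semigroup := by
  simpa [hp] using h.resolventOne_mem_generatorGraph (p.1 - p.2)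

lemma resolventOne_eq_of_mem_graph (ha : a ≠ 0) {p : C₀(E, ℝ) × C₀(E, ℝ)}
    (hp : p ∈ (L a lam).graph) : resolventOne h.fellerSemigroup (p.1 - p.2) = p.1 := by
  set w := resolventOne h.fellerSemigroup (p.1 - p.2)
  have hw : (w, w - (p.1 - p.2)) ∈ (L a lam).graph :=
    h.generatorGraph_semigroup_subset ha (h.resolventOne_mem_generatorGraph _)
  have hsub : genExpr a lam (w - p.1 : C₀(E, ℝ)) = (w - (p.1 - p.2) - p.2 : C₀(E, ℝ)) :=
    (mem_graph_L_iff.mp ((L a lam).graph.sub_mem hw hp)).2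
  rw [sub_sub, sub_add_cancel] at hsub
  exact sub_eq_zero.mp (eq_zero_of_genExpr_eq h.nonneg hsub)

theorem generatorGraph_semigroup (ha : a ≠ 0) :
    generatorGraph h.semigroup = ((L a lam).graph : Set _) :=
  (h.generatorGraph_semigroup_subset ha).antisymm fun _ hp =>
    h.mem_generatorGraph_of_resolventOne_eq (h.resolventOne_eq_of_mem_graph ha hp)

include h in
theorem isClosed_L (ha : a ≠ 0) : (L a lam).IsClosed := by
  have hgraph : ((L a lam).graph : Set (C₀(E, ℝ) × C₀(E, ℝ)))
      = {p | resolventOne h.fellerSemigroup (p.1 - p.2) = p.1} :=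
    Subset.antisymm (fun _ => h.resolventOne_eq_of_mem_graph ha) fun _ hp =>
      h.generatorGraph_semigroup_subset ha (h.mem_generatorGraph_of_resolventOne_eq hp)
  rw [LinearPMap.IsClosed, hgraph]
  exact isClosed_eq (h.isContractionSemigroup_fellerSemigroup.continuous_resolventOne.comp
    (continuous_fst.sub continuous_snd)) continuous_fst

end IsAdmissible

end Generator

theorem tendsto_survival_of_le_lam {a : ℝ} {lam : E → ℝ} (ha : 0 < a) (hcont : Continuous lam)
    {y₀ c : ℝ} (hc : 0 < c) (hle : ∀ (y : ℝ) (j : ℤˣ), y₀ ≤ sgn j * y → c ≤ lam (y, j)) (e : E) :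
    Tendsto (fun t => survival a lam t e) atTop (𝓝 0) :=
  tendsto_survival_of_eventually_le hcont hc
    ((eventually_le_sgn_mul_flow ha y₀ e).mono fun s => hle (flow a s e).1 e.2)

lemma closure_eq_of_isClosed {R X Y : Type*} [CommRing R] [AddCommGroup X] [AddCommGroup Y]
    [Module R X] [Module R Y] [TopologicalSpace X] [TopologicalSpace Y] [ContinuousAdd X]
    [ContinuousAdd Y] [TopologicalSpace R] [ContinuousSMul R X] [ContinuousSMul R Y]
    {f : X →ₗ.[R] Y} (hf : f.IsClosed) : f.closure = f :=
  LinearPMap.eq_of_eq_graph <| by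
    rw [← hf.isClosable.graph_closure_eq_closure_graph]
    exact hf.submodule_topologicalClosure_eq

end ZigZag

theorem mainTheorem8_general (a : ℝ) (ha : a ≠ 0) (lam : ZigZag.E → ℝ) (hcont : Continuous lam)
    (hnonneg : ∀ x, 0 ≤ lam x)
    (hsurv : ∀ e, Tendsto (fun t => ZigZag.survival a lam t e) atTop (𝓝 0)) :
    (ZigZag.L a lam).IsClosed ∧
    ∃ P : ℝ≥0 → Kernel ZigZag.E ZigZag.E,
      ZigZag.IsMarkovSemigroup P ∧
      ZigZag.generatorGraph P = ((ZigZag.L a lam).graph : Set _) ∧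
      ∀ e : ZigZag.E,
        (∃ μ : Measure (ℕ → Ioi (0 : ℝ)),
          ZigZag.IsWaitingTimes a lam e μ (fun n ω => ω n)) ∧
        ∀ (Ω : Type*) (mΩ : MeasurableSpace Ω) (μ : Measure Ω) (Z : ℕ → Ω → Ioi (0 : ℝ))
          (hZ : ZigZag.IsWaitingTimes a lam e μ Z),
          (∀ᵐ ω ∂μ, Tendsto (ZigZag.switchTime fun k => Z k ω) atTop atTop) ∧
          (∀ t, μ.map (ZigZag.process a e Z t) = P t e) ∧
          ZigZag.IsStrongMarkov μ (ZigZag.filtration a e hZ.measurable)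
            (ZigZag.process a e Z) P := by
  have h : ZigZag.IsAdmissible a lam := ⟨hcont, hnonneg, hsurv⟩
  refine ⟨h.isClosed_L ha, h.semigroup, h.isMarkovSemigroup, h.generatorGraph_semigroup ha,
    fun e => ⟨⟨h.seqKernel e, h.isWaitingTimes_seqKernel e⟩, fun _ _ _ _ hZ => ?_⟩⟩
  exact ⟨hZ.ae_tendsto_switchTime h, hZ.map_process h, hZ.isStrongMarkov h⟩

theorem mainTheorem8 (a : ℝ) (ha : 0 < a) (lam : ZigZag.E → ℝ) (hcont : Continuous lam)
    (hnonneg : ∀ x, 0 ≤ lam x)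
    (hlam : ∃ y₀ : ℝ, 0 ≤ y₀ ∧ ∃ lamMin : ℝ, 0 < lamMin ∧
      ∀ (y : ℝ) (j : ℤˣ), y₀ ≤ ZigZag.sgn j * y → lamMin ≤ lam (y, j)) :
    (ZigZag.L a lam).IsClosable ∧
    ∃ P : ℝ≥0 → Kernel ZigZag.E ZigZag.E,
      ZigZag.IsMarkovSemigroup P ∧
      ZigZag.generatorGraph P = ((ZigZag.L a lam).closure.graph : Set _) ∧
      ∀ e : ZigZag.E,
        -- the process exists
        (∃ μ : Measure (ℕ → Ioi (0 : ℝ)),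
          ZigZag.IsWaitingTimes a lam e μ (fun n ω => ω n)) ∧
        -- and every version of it has the asserted properties
        ∀ (Ω : Type*) (mΩ : MeasurableSpace Ω) (μ : Measure Ω) (Z : ℕ → Ω → Ioi (0 : ℝ))
          (hZ : ZigZag.IsWaitingTimes a lam e μ Z),
          (∀ᵐ ω ∂μ, Tendsto (ZigZag.switchTime fun k => Z k ω) atTop atTop) ∧
          (∀ t, μ.map (ZigZag.process a e Z t) = P t e) ∧
          ZigZag.IsStrongMarkov μ (ZigZag.filtration a e hZ.measurable)
            (ZigZag.process a e Z) P := by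
  obtain ⟨_, -, _, hpos, hle⟩ := hlam
  obtain ⟨hL, hP⟩ := mainTheorem8_general a ha.ne' lam hcont hnonneg
    (ZigZag.tendsto_survival_of_le_lam ha hcont hpos hle)
  exact ⟨hL.isClosable, (ZigZag.closure_eq_of_isClosed hL).symm ▸ hP⟩
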